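/- Let $G(s)=C_G(sI-A_G)^{-1}B_G+D_G$ and $F(s)=C_F(sI-A_F)^{-1}B_F$ be stable real-rational single-input single-output transfer functions, $G$ proper and $F$ strictly proper, given by real state-space matrices with $A_G$, $A_F$ Hurwitz. Let $h>0$ and let $m\ge 0$ be an integer. A digital filter $K$ is a causal convolution filter with real impulse response $(K_k)_{k\ge0}$ and transfer function $K(z)=\sum_k K_kz^{-k}$ (extended to points where the series diverges by clearing a polynomial denominator in $z^{-1}$, as for rational $K$); it is stable if $\sum_k|K_k|<\infty$. Let $\mathcal S_h$ be the ideal sampler $(\mathcal S_hu)[n]=u(nh)$, let $\mathcal H_h$ be the zero-order hold, which produces the value $\psi[n]$ on $[nh,(n+1)h)$, and put $$\mathcal E=(e^{-mhs}G-\mathcal H_hK\mathcal S_h)F .$$ The lifted system $\widetilde{\mathcal E}$ is $\mathcal E$ seen as a discrete-time system with signals $(w(kh+\cdot))_{k\ge0}$ in $L^2[0,h)$: if $\mathcal E_kf$ denotes the restriction to $[kh,(k+1)h)$, shifted to $[0,h)$, of the response of $\mathcal E$ to $f\in L^2[0,h)$ (extended by zero), then $\widetilde{\mathcal E}(z)=\sum_k\mathcal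 E_kz^{-k}$ (extended as for $K$), an operator on the complex space $L^2[0,h)$. For $N\ge1$ and a single-input single-output system $P$ with matrices $(A,B,C,D)$ let $(A_d,B_d,C,D)$, where $A_d=e^{Ah/N}$ and $B_d=\int_0^{h/N}e^{At}B\,dt$, be its step-invariant discretization with period $h/N$, and let $P_N(z)$ be the transfer function of its discrete-time lifting, that is, of the $N$-input $N$-output system with state matrix $A_d^N$, input matrix $[A_d^{N-1}B_d,\dots,A_dB_d,B_d]$, output matrix $[C^\top,(CA_d)^\top,\dots,(CA_d^{N-1})^\top]^\top$ and lower triangular Toeplitz feedthrough matrix with first column $(D,CB_d,CA_dB_d,\dots,CA_d^{N-2}B_d)^\top$. With $H_N=[1,\dots,1]^\top$ and $S_N=[1,0,\dots,0]$ put $$E_N(z)=\bigl(z^{-m}G_N(z)-H_NK(z)S_N\bigr)F_N(z).$$ Then for each fixed digital filter $K$ and each $\omega\in[0,2\pi/h)$ such that $K(z)$ has no pole at $e^{j\omega h}$, $\widetilde{\mathcal E}(e^{j\omega h})$ is a well-defined bounded operator and $$\|E_N(e^{j\omega h})\|\longrightarrow\|\widetilde{\mathcal E}(e^{j\omega h})\|\qquad(N\to\infty),$$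 where the left-hand norm is the largest singular value and the right-hand norm is the operator norm on $L^2[0,h)$. The convergence is uniform in $\omega\in[0,2\pi/h)$ and in $K\in\mathcal K$ for every set $\mathcal K$ of stable filters that is compact in the topology of the $H^\infty$ norm (uniform convergence of $K(z)$ on the unit circle); such filters have no pole on the unit circle. -/

import Mathlib

open MeasureTheory Filter Topology Set

namespace SampledData

noncomputable section

/-! ### State-space systems -/

/-- State-space matrices `(A, B, C, D)` of a real-rational proper system with `n` states,
`p` inputs and `q` outputs. -/
structure StateSpace (n p q : ℕ) where
  A : Matrix (Fin n) (Fin n) ℝ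
  B : Matrix (Fin n) (Fin p) ℝ
  C : Matrix (Fin q) (Fin n) ℝ
  D : Matrix (Fin q) (Fin p) ℝ

namespace StateSpace

variable {n p q : ℕ}

/-- Stability of a continuous-time system: every eigenvalue of `A` has negative real part. -/
def IsHurwitz (P : StateSpace n p q) : Prop :=
  ∀ s ∈ spectrum ℂ (P.A.map (fun a : ℝ => (a : ℂ))), s.re < 0

/-- The transfer function is strictly proper. -/
def IsStrictlyProper (P : StateSpace n p q) : Prop := P.D = 0

/-- The transfer function `C (z I - A)⁻¹ B + D` at the complex number `z`. -/
def transfer (P : StateSpace n p q) (z : ℂ) : Matrix (Fin q) (Fin p) ℂ :=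
  P.C.map (fun a : ℝ => (a : ℂ)) *
      (z • (1 : Matrix (Fin n) (Fin n) ℂ) - P.A.map (fun a : ℝ => (a : ℂ)))⁻¹ *
      P.B.map (fun a : ℝ => (a : ℂ)) +
    P.D.map (fun a : ℝ => (a : ℂ))

/-- Step-invariant transformation with sampling period `τ`. -/
def c2d (P : StateSpace n p q) (τ : ℝ) : StateSpace n p q where
  A := NormedSpace.exp (τ • P.A)
  B := Matrix.of fun i j => ∫ t in (0 : ℝ)..τ, (NormedSpace.exp (t • P.A) * P.B) i j
  C := P.C
  D := P.D

/-- Discrete-time lifting by a factor `N` of a single-input single-output system. -/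
def lift (P : StateSpace n 1 1) (N : ℕ) : StateSpace n N N where
  A := P.A ^ N
  B := Matrix.of fun i j => (P.A ^ (N - 1 - (j : ℕ)) * P.B) i 0
  C := Matrix.of fun i j => (P.C * P.A ^ (i : ℕ)) 0 j
  D := Matrix.of fun i j =>
    if (j : ℕ) = (i : ℕ) then P.D 0 0
    else if (j : ℕ) < (i : ℕ) then (P.C * P.A ^ ((i : ℕ) - (j : ℕ) - 1) * P.B) 0 0
    else 0

/-- The time-domain action of a single-input single-output continuous-time system on signals on
`[0, ∞)` with zero initial state: `y(t) = ∫₀ᵗ C e^{A (t - τ)} B u(τ) dτ + D u(t)`. -/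
def output (P : StateSpace n 1 1) (u : ℝ → ℂ) (t : ℝ) : ℂ :=
  (∫ τ in (0 : ℝ)..t,
      (((P.C * NormedSpace.exp ((t - τ) • P.A) * P.B) 0 0 : ℝ) : ℂ) * u τ) +
    ((P.D 0 0 : ℝ) : ℂ) * u t

end StateSpace

/-! ### The sampled-data error system in the time domain -/

/-- Delay by `l ≥ 0` of a signal on `[0, ∞)`. -/
def delay (l : ℝ) (y : ℝ → ℂ) (t : ℝ) : ℂ := if l ≤ t then y (t - l) else 0

/-- Ideal sampler with period `h`. -/
def sampler (h : ℝ) (u : ℝ → ℂ) (n : ℕ) : ℂ := u (n * h)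

/-- Zero-order hold with period `h`: the value on `[n h, (n + 1) h)` is `ψ n`. -/
def hold (h : ℝ) (ψ : ℕ → ℂ) (t : ℝ) : ℂ := if 0 ≤ t then ψ ⌊t / h⌋₊ else 0

/-- The causal digital filter with real impulse response `K`. -/
def digitalFilter (K : ℕ → ℝ) (v : ℕ → ℂ) (n : ℕ) : ℂ :=
  ∑ i ∈ Finset.range (n + 1), (K (n - i) : ℂ) * v i

/-- The error system `(e^{-m h s} G - H_h K S_h) F`. -/
def errorSystem {a b : ℕ} (G : StateSpace a 1 1) (F : StateSpace b 1 1) (h : ℝ) (m : ℕ)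
    (K : ℕ → ℝ) (w : ℝ → ℂ) (t : ℝ) : ℂ :=
  delay (m * h) (G.output (F.output w)) t -
    hold h (digitalFilter K (sampler h (F.output w))) t

/-! ### Transfer functions of discrete-time impulse responses -/

section Transfer

variable {V : Type*} [NormedAddCommGroup V] [NormedSpace ℂ V]

/-- `HasTransferValue Φ z T`: the transfer function `∑ₖ Φ k z⁻ᵏ` of the impulse response `Φ` is
regular at `z`, with value `T`. If the series converges at `z`, take `r = 1`; in general a
denominator `r(z⁻¹)` that does not vanish at `z` may be cleared first, so that, for instance, a
rational transfer function has a value at every `z ≠ 0` that is not a pole. -/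
def HasTransferValue (Φ : ℕ → V) (z : ℂ) (T : V) : Prop :=
  ∃ r : Polynomial ℂ, r.eval z⁻¹ ≠ 0 ∧
    HasSum (fun k : ℕ => z⁻¹ ^ k • ∑ i ∈ Finset.range (k + 1), r.coeff i • Φ (k - i))
      (r.eval z⁻¹ • T)

theorem HasTransferValue.mul_aux {Φ : ℕ → V} {x : ℂ} {r : Polynomial ℂ} {s : V}
    (hr : HasSum (fun k : ℕ => x ^ k • ∑ i ∈ Finset.range (k + 1), r.coeff i • Φ (k - i)) s)
    (q : Polynomial ℂ) :
    HasSum (fun k : ℕ => x ^ k • ∑ i ∈ Finset.range (k + 1), (q * r).coeff i • Φ (k - i))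
      (q.eval x • s) := by
  induction q using Polynomial.induction_on with
  | C c =>
    simpa [Finset.smul_sum, smul_smul, mul_left_comm, mul_assoc] using hr.const_smul c
  | add p q hp hq =>
    simpa [add_mul, add_smul, Finset.sum_add_distrib, smul_add] using hp.add hq
  | monomial n c ih =>
    have key := ih.const_smul x
    have : (Polynomial.C c * Polynomial.X ^ (n + 1) * r)
        = Polynomial.X * (Polynomial.C c * Polynomial.X ^ n * r) := by ring
    rw [this]
    rw [← hasSum_nat_add_iff' 1]
    convert key using 1
    · funext k
      rw [Finset.sum_range_succ']
      simp [pow_succ', smul_smul, Polynomial.coeff_X_mul]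
    · simp [smul_smul, pow_succ]
      congr 1
      ring

theorem HasTransferValue.unique {Φ : ℕ → V} {z : ℂ} {T T' : V}
    (hT : HasTransferValue Φ z T) (hT' : HasTransferValue Φ z T') : T = T' := by
  obtain ⟨r, hr, hs⟩ := hT
  obtain ⟨r', hr', hs'⟩ := hT'
  have h1 := HasTransferValue.mul_aux hs r'
  have h2 := HasTransferValue.mul_aux hs' r
  rw [mul_comm r' r] at h1
  have h3 := h1.unique h2
  rw [smul_smul, smul_smul, mul_comm] at h3
  exact smul_right_injective V (mul_ne_zero hr hr') h3

open Classical in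
/-- The value at `z` of the transfer function of `Φ` (zero if it is not regular at `z`). -/
def transferValue (Φ : ℕ → V) (z : ℂ) : V :=
  if hΦ : ∃ T, HasTransferValue Φ z T then hΦ.choose else 0

theorem HasTransferValue.transferValue_eq {Φ : ℕ → V} {z : ℂ} {T : V}
    (hT : HasTransferValue Φ z T) : transferValue Φ z = T := by
  have hex : ∃ T, HasTransferValue Φ z T := ⟨T, hT⟩
  rw [transferValue, dif_pos hex]
  exact hex.choose_spec.unique hT

end Transfer

/-- The digital filter with impulse response `K` has no pole at `z`. -/
def IsRegularAt (K : ℕ → ℝ) (z : ℂ) : Prop :=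
  ∃ c : ℂ, HasTransferValue (fun k => (K k : ℂ)) z c

/-- The transfer function `K(z)` of the digital filter with impulse response `K`. -/
def filterTransfer (K : ℕ → ℝ) (z : ℂ) : ℂ := transferValue (fun k => (K k : ℂ)) z

/-- A (BIBO) stable digital filter. -/
structure StableFilter where
  impulse : ℕ → ℝ
  stable : Summable fun n => |impulse n|

/-- The topology of the `H^∞` norm: uniform convergence of `K(z)` on the unit circle. -/
instance : TopologicalSpace StableFilter :=
  TopologicalSpace.induced
    (fun K => UniformFun.ofFun fun z : Circle => filterTransfer K.impulse (z : ℂ)) inferInstance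

/-! ### Continuous-time lifting -/

/-- The (complex) space `L²[0, h)`. -/
abbrev L2 (h : ℝ) : Type := Lp ℂ 2 (volume.restrict (Ico (0 : ℝ) h))

/-- Lifting of a signal on `[0, ∞)`: the `k`-th piece is `t ↦ y(k h + t)`, `0 ≤ t < h`. -/
def lifting (h : ℝ) (y : ℝ → ℂ) (k : ℕ) (t : ℝ) : ℂ := y (k * h + t)

/-- The inverse of the lifting. -/
def unlifting (h : ℝ) (y : ℕ → ℝ → ℂ) (t : ℝ) : ℂ :=
  if 0 ≤ t then y ⌊t / h⌋₊ (t - ⌊t / h⌋₊ * h) else 0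

/-- `Φ` is the operator-valued impulse response of the lifted system
`lifting ∘ 𝓔 ∘ unlifting`: its response to the sequence `(f, 0, 0, …)` is `(Φ 0 f, Φ 1 f, …)`. -/
def IsLiftedImpulseResponse (h : ℝ) (𝓔 : (ℝ → ℂ) → ℝ → ℂ) (Φ : ℕ → L2 h →L[ℂ] L2 h) : Prop :=
  ∀ (k : ℕ) (f : L2 h), ⇑(Φ k f) =ᵐ[volume.restrict (Ico (0 : ℝ) h)]
    lifting h (𝓔 (unlifting h (Pi.single 0 (f : ℝ → ℂ)))) k

/-- The bounded operator `T` on `L²[0, h)` is the value at `z` of the transfer function of the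
lifted system of `𝓔`. -/
def IsLiftedTransferValue (h : ℝ) (𝓔 : (ℝ → ℂ) → ℝ → ℂ) (z : ℂ) (T : L2 h →L[ℂ] L2 h) : Prop :=
  ∃ Φ : ℕ → L2 h →L[ℂ] L2 h, IsLiftedImpulseResponse h 𝓔 Φ ∧ HasTransferValue Φ z T

/-! ### Fast sample/hold approximation -/

/-- `H_N = [1, …, 1]ᵀ`. -/
def holdVec (N : ℕ) : Matrix (Fin N) (Fin 1) ℂ := Matrix.of fun _ _ => 1

/-- `S_N = [1, 0, …, 0]`. -/
def sampleVec (N : ℕ) : Matrix (Fin 1) (Fin N) ℂ :=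
  Matrix.of fun _ j => if (j : ℕ) = 0 then 1 else 0

/-- The fast sample/hold approximation `E_N(z) = (z⁻ᵐ G_N(z) - H_N K(z) S_N) F_N(z)` of the error
system. Here `z` is the variable of the lifted (rate `h`) system, in which the delay by `m h`,
that is by `m N` fast sampling periods, is the factor `z⁻ᵐ`. -/
def fastApprox {a b : ℕ} (G : StateSpace a 1 1) (F : StateSpace b 1 1) (h : ℝ) (m : ℕ)
    (K : ℕ → ℝ) (N : ℕ) (z : ℂ) : Matrix (Fin N) (Fin N) ℂ :=
  (z⁻¹ ^ m • ((G.c2d (h / N)).lift N).transfer z -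
      filterTransfer K z • (holdVec N * sampleVec N)) *
    ((F.c2d (h / N)).lift N).transfer z

/-- The largest singular value of a complex matrix. -/
def matNorm {N : ℕ} (M : Matrix (Fin N) (Fin N) ℂ) : ℝ := ‖Matrix.toEuclideanCLM (𝕜 := ℂ) M‖

/-- The point `e^{j ω h}` of the unit circle. -/
def circlePt (h ω : ℝ) : ℂ := Complex.exp (Complex.I * (ω * h : ℝ))

end

end SampledData

/-!
The error system is lifted one period at a time. For a system with matrices `(A, B, C)` let
`M = exp (h A)`; the eigenvalues of `M` are the numbers `exp (h l)` with `l` an eigenvalue of `A`,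
so by Gelfand's formula the powers of `M` are absolutely summable. The lifting of the strictly
proper part has the transfer function with the bounded kernel

`k_z(t, τ) = 1_{τ < t} C exp ((t - τ) A) B + C exp ((t - τ) A) (z - M)⁻¹ M B`

on `[0, h)²`, obtained by summing the geometric series of the responses over the successive periods
(`hasSum_respOp`). Evaluation of the first variable at `0` gives the transfer function of the
sampled output; the two cases are treated together by observing the output at times `θ t`.

The fast-sampled transfer matrix is the same object on a grid: its entry `(i, j)` is the integral
over cell `j` of `k_z(t_i, ·)`, where `t_i = i h / N` (`StateSpace.transfer_lift_c2d`). Embedding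
`ℂᴺ` isometrically into `L²[0, h)` as step functions turns an `N × N` matrix into an integral
operator with a piecewise constant kernel and the same norm (`norm_stepOp`,
`stepOp_eq_kernelOp`), and is multiplicative. The piecewise constant kernel of the fast-sampled
system differs from `k_z` by `O(1 / N)` off the diagonal cells, where `k_z` is Lipschitz, and by
`O(1)` on them, uniformly for `|z| = 1`. By the Cauchy-Schwarz inequality in each row the operators
therefore differ by `O(1 / √N)` in norm (`exists_norm_fastOp_sub_le`).

Both error operators are built by the same products and sums from these pieces. The feedthrough of
`G` and the sampler, neither of which converges in norm by itself, occur only multiplied by the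
strictly proper `F`. Hence the norms differ by at most `C (1 + |K(z)|) / √N`
(`exists_abs_matNorm_sub_le`), which gives the pointwise limit, and the uniform one since a
compact set of stable filters is bounded in the `H^∞` norm.

That the limit operator is the transfer function of the lifted error system is a computation in
the time domain (`isLiftedImpulseResponse_errorRespOp`) followed by Cauchy products
(`hasTransferValue_errorRespOp`); a denominator that regularizes `K` also regularizes its
convolution with the absolutely summable sampled response of `F`.
-/

namespace SampledData

/-! ### Matrix exponentials -/

/-- The complexification of a real matrix. -/
noncomputable abbrev cmat {p q : ℕ} (X : Matrix (Fin p) (Fin q) ℝ) : Matrix (Fin p) (Fin q) ℂ :=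
  X.map (fun a : ℝ => (a : ℂ))

theorem cmat_mul {p q r : ℕ} (X : Matrix (Fin p) (Fin q) ℝ) (Y : Matrix (Fin q) (Fin r) ℝ) :
    cmat (X * Y) = cmat X * cmat Y :=
  Matrix.map_mul (f := Complex.ofRealHom)

theorem cmat_pow {p : ℕ} (X : Matrix (Fin p) (Fin p) ℝ) (k : ℕ) : cmat (X ^ k) = cmat X ^ k :=
  map_pow (Complex.ofRealHom.mapMatrix) X k

/-- The flow `exp (s A)` at a real time `s`. No norm is fixed, so that the definition applies to
matrices with their product topology, on which a norm is brought in only locally. -/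
noncomputable def flow {𝔸 : Type*} [Ring 𝔸] [Algebra ℂ 𝔸] [TopologicalSpace 𝔸]
    [IsTopologicalRing 𝔸] (A : 𝔸) (s : ℝ) : 𝔸 :=
  NormedSpace.exp ((s : ℂ) • A)

section Flow

variable {𝔸 : Type*} [NormedRing 𝔸] [NormedAlgebra ℂ 𝔸]

theorem flow_zero (A : 𝔸) : flow A 0 = 1 := by simp [flow]

variable [CompleteSpace 𝔸]

theorem flow_add (A : 𝔸) (s t : ℝ) : flow A (s + t) = flow A s * flow A t := by
  let _ : NormedAlgebra ℚ 𝔸 := NormedAlgebra.restrictScalars ℚ ℂ 𝔸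
  rw [flow, flow, flow, Complex.ofReal_add, add_smul]
  exact NormedSpace.exp_add_of_commute (((Commute.refl A).smul_left _).smul_right _)

theorem flow_natMul (A : 𝔸) (k : ℕ) (s : ℝ) : flow A (k * s) = flow A s ^ k := by
  induction k with
  | zero => simp [flow_zero]
  | succ k ih => rw [pow_succ, ← ih, ← flow_add]; push_cast; ring_nf

theorem flow_commute (A : 𝔸) (s t : ℝ) : Commute (flow A s) (flow A t) := by
  rw [Commute, SemiconjBy, ← flow_add, ← flow_add, add_comm]

theorem continuous_flow (A : 𝔸) : Continuous (flow A) := by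
  let _ : NormedAlgebra ℚ 𝔸 := NormedAlgebra.restrictScalars ℚ ℂ 𝔸
  exact NormedSpace.exp_continuous.comp (by fun_prop)

/-- The flow is Lipschitz on bounded time intervals. -/
theorem exists_flow_lipschitz (A : 𝔸) (T : ℝ) : ∃ L : ℝ, 0 ≤ L ∧ ∀ s t : ℝ, |s| ≤ T → |t| ≤ T →
    ‖flow A s - flow A t‖ ≤ L * |s - t| := by
  let _ : NormedAlgebra ℚ 𝔸 := NormedAlgebra.restrictScalars ℚ ℂ 𝔸
  have hcont : Continuous fun u : ℂ => NormedSpace.exp (u • A) * A :=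
    (NormedSpace.exp_continuous.comp (by fun_prop)).mul continuous_const
  obtain ⟨L, hL⟩ := (isCompact_closedBall (0 : ℂ) T).exists_bound_of_continuousOn
    hcont.continuousOn
  refine ⟨max L 0, le_max_right _ _, fun s t hs ht => ?_⟩
  have := (convex_closedBall (0 : ℂ) T).norm_image_sub_le_of_norm_hasDerivWithin_le
    (f := fun u : ℂ => NormedSpace.exp (u • A)) (C := max L 0)
    (fun u _ => (hasDerivAt_exp_smul_const (𝕂 := ℂ) A u).hasDerivWithinAt)
    (fun u hu => (hL u hu).trans (le_max_left _ _)) (x := (t : ℂ)) (y := (s : ℂ))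
    (by simpa using ht) (by simpa using hs)
  simpa [flow, ← Complex.ofReal_sub] using this

theorem exists_flow_bound (A : 𝔸) (T : ℝ) : ∃ L : ℝ, 0 ≤ L ∧ ∀ s : ℝ, |s| ≤ T → ‖flow A s‖ ≤ L := by
  obtain ⟨L, hL⟩ := (isCompact_Icc (a := -T) (b := T)).exists_bound_of_continuousOn
    (continuous_flow A).continuousOn
  exact ⟨max L 0, le_max_right _ _, fun s hs => (hL s (abs_le.1 hs)).trans (le_max_left _ _)⟩

end Flow

/-- By Gelfand's formula, the powers of an element whose spectrum lies in the open unit disc are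
absolutely summable. -/
theorem summable_norm_pow_of_spectrum {𝔸 : Type*} [NormedRing 𝔸] [NormedAlgebra ℂ 𝔸]
    [CompleteSpace 𝔸] {M : 𝔸} (hM : ∀ μ ∈ spectrum ℂ M, ‖μ‖ < 1) :
    Summable fun k : ℕ => ‖M ^ k‖ := by
  have hρ : spectralRadius ℂ M < 1 := by
    rcases subsingleton_or_nontrivial 𝔸 with h𝔸 | h𝔸
    · rw [Subsingleton.elim M 0, spectrum.spectralRadius_zero]
      exact one_pos
    · exact spectrum.spectralRadius_lt_of_forall_lt M (r := 1) fun μ hμ => hM μ hμ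
  obtain ⟨r, hr, hr1⟩ := ENNReal.lt_iff_exists_nnreal_btwn.1 hρ
  have hev := (spectrum.pow_nnnorm_pow_one_div_tendsto_nhds_spectralRadius M).eventually_lt_const hr
  refine Summable.of_norm_bounded_eventually_nat (g := fun k => (r : ℝ) ^ k)
    (summable_geometric_of_lt_one r.2 (by exact_mod_cast hr1)) ?_
  filter_upwards [hev, eventually_gt_atTop 0] with k hk hk0
  rw [norm_norm]
  have hk' : ((‖M ^ k‖₊ : ENNReal) ^ (1 / k : ℝ)) ^ (k : ℝ) ≤ (r : ENNReal) ^ (k : ℝ) :=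
    ENNReal.rpow_le_rpow hk.le (Nat.cast_nonneg k)
  rw [← ENNReal.rpow_mul, one_div, inv_mul_cancel₀ (by positivity), ENNReal.rpow_one,
    ENNReal.rpow_natCast] at hk'
  exact_mod_cast hk'

section Matrices

variable {n : ℕ}

theorem cmat_exp (A : Matrix (Fin n) (Fin n) ℝ) (s : ℝ) :
    cmat (NormedSpace.exp (s • A)) = flow (cmat A) s := by
  let _ : NormedRing (Matrix (Fin n) (Fin n) ℝ) := Matrix.linftyOpNormedRing
  let _ : NormedAlgebra ℝ (Matrix (Fin n) (Fin n) ℝ) := Matrix.linftyOpNormedAlgebra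
  let _ : NormedAlgebra ℚ (Matrix (Fin n) (Fin n) ℝ) := NormedAlgebra.restrictScalars ℚ ℝ _
  let _ : NormedRing (Matrix (Fin n) (Fin n) ℂ) := Matrix.linftyOpNormedRing
  let _ : NormedAlgebra ℂ (Matrix (Fin n) (Fin n) ℂ) := Matrix.linftyOpNormedAlgebra
  have hc : Continuous fun X : Matrix (Fin n) (Fin n) ℝ => X.map (fun a : ℝ => (a : ℂ)) :=
    continuous_id.matrix_map Complex.continuous_ofReal
  have h : cmat (NormedSpace.exp (s • A)) = NormedSpace.exp (cmat (s • A)) :=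
    NormedSpace.map_exp (Complex.ofRealHom.mapMatrix (m := Fin n)) hc (s • A)
  have h' : cmat (s • A) = (s : ℂ) • cmat A := by
    ext i j
    simp
  rw [h, h', flow]

theorem matrix_flow_add (A : Matrix (Fin n) (Fin n) ℂ) (s t : ℝ) :
    flow A (s + t) = flow A s * flow A t := by
  let _ : NormedRing (Matrix (Fin n) (Fin n) ℂ) := Matrix.linftyOpNormedRing
  let _ : NormedAlgebra ℂ (Matrix (Fin n) (Fin n) ℂ) := Matrix.linftyOpNormedAlgebra
  exact flow_add A s t

theorem matrix_flow_natMul (A : Matrix (Fin n) (Fin n) ℂ) (k : ℕ) (s : ℝ) :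
    flow A (k * s) = flow A s ^ k := by
  let _ : NormedRing (Matrix (Fin n) (Fin n) ℂ) := Matrix.linftyOpNormedRing
  let _ : NormedAlgebra ℂ (Matrix (Fin n) (Fin n) ℂ) := Matrix.linftyOpNormedAlgebra
  exact flow_natMul A k s

theorem continuous_matrix_exp (A : Matrix (Fin n) (Fin n) ℝ) :
    Continuous fun t : ℝ => NormedSpace.exp (t • A) := by
  let _ : NormedRing (Matrix (Fin n) (Fin n) ℝ) := Matrix.linftyOpNormedRing
  let _ : NormedAlgebra ℝ (Matrix (Fin n) (Fin n) ℝ) := Matrix.linftyOpNormedAlgebra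
  let _ : NormedAlgebra ℚ (Matrix (Fin n) (Fin n) ℝ) := NormedAlgebra.restrictScalars ℚ ℝ _
  exact NormedSpace.exp_continuous.comp (by fun_prop)

theorem flow_mulVec_of_eigenvector {A : Matrix (Fin n) (Fin n) ℂ} {v : Fin n → ℂ} {l : ℂ}
    (hv : A.mulVec v = l • v) (s : ℝ) : (flow A s).mulVec v = Complex.exp (s * l) • v := by
  let _ : NormedRing (Matrix (Fin n) (Fin n) ℂ) := Matrix.linftyOpNormedRing
  let _ : NormedAlgebra ℂ (Matrix (Fin n) (Fin n) ℂ) := Matrix.linftyOpNormedAlgebra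
  have h1 := NormedSpace.exp_series_hasSum_exp' (𝕂 := ℂ) ((s : ℂ) • A)
  have h2 := NormedSpace.exp_series_hasSum_exp' (𝕂 := ℂ) ((s : ℂ) * l)
  let ev : Matrix (Fin n) (Fin n) ℂ →L[ℂ] (Fin n → ℂ) := LinearMap.toContinuousLinearMap
    { toFun := fun X => X.mulVec v
      map_add' := fun X Y => Matrix.add_mulVec X Y v
      map_smul' := fun c X => Matrix.smul_mulVec c X v }
  have hpow : ∀ k : ℕ, (((s : ℂ) • A) ^ k).mulVec v = ((s : ℂ) * l) ^ k • v := by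
    intro k
    induction k with
    | zero => simp
    | succ k ih =>
      rw [pow_succ, ← Matrix.mulVec_mulVec, Matrix.smul_mulVec, hv, smul_smul,
        Matrix.mulVec_smul, ih, smul_smul, pow_succ']
  have h3 := h1.mapL ev
  have h4 := h2.smul_const v
  have h5 : (fun k : ℕ => ev ((k.factorial⁻¹ : ℂ) • ((s : ℂ) • A) ^ k)) =
      fun k : ℕ => ((k.factorial⁻¹ : ℂ) • ((s : ℂ) * l) ^ k) • v := by
    funext k
    rw [map_smul, smul_assoc, ← hpow]
    rfl
  rw [h5] at h3
  rw [Complex.exp_eq_exp_ℂ]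
  exact h3.unique h4

/-- An eigenvalue of `exp (s A)` is `exp (s l)` for an eigenvalue `l` of `A`: the eigenspace is
invariant under `A`, which has an eigenvector in it. -/
theorem spectrum_flow {A : Matrix (Fin n) (Fin n) ℂ} {s : ℝ} {μ : ℂ}
    (hμ : μ ∈ spectrum ℂ (flow A s)) : ∃ l ∈ spectrum ℂ A, μ = Complex.exp (s * l) := by
  have hcomm : Commute (flow A s) A := by
    rw [flow]
    exact (((Commute.refl A).smul_left (s : ℂ))).exp_left
  rw [← Matrix.spectrum_toLin', ← Module.End.hasEigenvalue_iff_mem_spectrum] at hμ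
  set E := Module.End.eigenspace (Matrix.toLin' (flow A s)) μ with hE
  have hmaps : ∀ v ∈ E, Matrix.toLin' A v ∈ E := by
    intro v hv
    rw [hE, Module.End.mem_eigenspace_iff] at hv ⊢
    rw [Matrix.toLin'_apply] at hv
    rw [Matrix.toLin'_apply, Matrix.toLin'_apply, Matrix.mulVec_mulVec, hcomm.eq,
      ← Matrix.mulVec_mulVec, hv, Matrix.mulVec_smul]
  have : Nontrivial E := Submodule.nontrivial_iff_ne_bot.2 hμ
  obtain ⟨l, hl⟩ := Module.End.exists_eigenvalue ((Matrix.toLin' A).restrict hmaps)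
  obtain ⟨v, hv⟩ := hl.exists_hasEigenvector
  have hv0 : (v : Fin n → ℂ) ≠ 0 := fun h => hv.2 (Subtype.ext h)
  have hAv : A.mulVec v = l • (v : Fin n → ℂ) := by
    have := congrArg Subtype.val hv.apply_eq_smul
    simpa using this
  have hMv : (flow A s).mulVec v = μ • (v : Fin n → ℂ) := by
    have := Module.End.mem_eigenspace_iff.1 v.2
    simpa using this
  refine ⟨l, ?_, ?_⟩
  · rw [← Matrix.spectrum_toLin', ← Module.End.hasEigenvalue_iff_mem_spectrum]
    exact Module.End.hasEigenvalue_of_hasEigenvector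
      (x := (v : Fin n → ℂ)) ⟨Module.End.mem_eigenspace_iff.2 (by simpa using hAv), hv0⟩
  · rw [flow_mulVec_of_eigenvector hAv] at hMv
    exact (smul_left_injective ℂ hv0 hMv).symm

/-! ### The fast-sampled lifted system -/

namespace StateSpace

theorem IsHurwitz.norm_lt_one_of_mem_spectrum {p q : ℕ} {P : StateSpace n p q} (hP : P.IsHurwitz)
    {h : ℝ} (hh : 0 < h) {μ : ℂ} (hμ : μ ∈ spectrum ℂ (flow (cmat P.A) h)) : ‖μ‖ < 1 := by
  obtain ⟨l, hl, rfl⟩ := spectrum_flow hμ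
  rw [Complex.norm_exp, Real.exp_lt_one_iff, Complex.re_ofReal_mul]
  exact mul_neg_of_pos_of_neg hh (hP l hl)

/-- The functional `X ↦ C X B` on square matrices; the impulse response of `P` is its value at
`exp (t A)`. -/
noncomputable def io (P : StateSpace n 1 1) : Matrix (Fin n) (Fin n) ℂ →L[ℂ] ℂ :=
  LinearMap.toContinuousLinearMap
    { toFun := fun X => (cmat P.C * X * cmat P.B) 0 0
      map_add' := by intro X Y; simp [Matrix.mul_add, Matrix.add_mul]
      map_smul' := by intro r X; simp }

theorem io_apply (P : StateSpace n 1 1) (X : Matrix (Fin n) (Fin n) ℂ) :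
    P.io X = (cmat P.C * X * cmat P.B) 0 0 := rfl

theorem ofReal_impulse (P : StateSpace n 1 1) (s : ℝ) :
    (((P.C * NormedSpace.exp (s • P.A) * P.B) 0 0 : ℝ) : ℂ) = P.io (flow (cmat P.A) s) := by
  rw [io_apply, ← cmat_exp, ← cmat_mul, ← cmat_mul]
  rfl

/-- The input matrix of the step-invariant discretization, with the integral moved outside. -/
theorem io_c2d (P : StateSpace n 1 1) (τ : ℝ) (X : Matrix (Fin n) (Fin n) ℂ) :
    (cmat P.C * X * cmat (P.c2d τ).B) 0 0 =
      ∫ s in (0 : ℝ)..τ, P.io (X * flow (cmat P.A) s) := by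
  have hcont : Continuous fun t : ℝ => NormedSpace.exp (t • P.A) * P.B :=
    (continuous_matrix_exp P.A).matrix_mul continuous_const
  have h2 : ∀ s : ℝ, P.io (X * flow (cmat P.A) s) =
      ∑ j, (cmat P.C * X) 0 j * (((NormedSpace.exp (s • P.A) * P.B) j 0 : ℝ) : ℂ) := by
    intro s
    rw [io_apply, ← cmat_exp, ← Matrix.mul_assoc, Matrix.mul_assoc, ← cmat_mul, Matrix.mul_apply]
    rfl
  simp_rw [h2]
  rw [intervalIntegral.integral_finsetSum]
  · rw [Matrix.mul_apply]
    refine Finset.sum_congr rfl fun j _ => ?_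
    rw [intervalIntegral.integral_const_mul, intervalIntegral.integral_ofReal]
    rfl
  · intro j _
    refine Continuous.intervalIntegrable ?_ _ _
    exact continuous_const.mul (Complex.continuous_ofReal.comp (hcont.matrix_elem j 0))

/-- The entries of the transfer function of the fast-sampled lifted system. The integrals over
`[0, τ]` are integrals over cell `j` of the transfer kernel at the node `i τ`. -/
theorem transfer_lift_c2d (P : StateSpace n 1 1) (τ : ℝ) (N : ℕ) (z : ℂ) (i j : Fin N) :
    ((P.c2d τ).lift N).transfer z i j =
      (∫ s in (0 : ℝ)..τ, P.io (flow (cmat P.A) (i * τ) *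
          Ring.inverse (z • 1 - flow (cmat P.A) (N * τ)) *
          flow (cmat P.A) ((N - 1 - j) * τ + s))) +
        (if (j : ℕ) < i then
          ∫ s in (0 : ℝ)..τ, P.io (flow (cmat P.A) ((i - j - 1) * τ + s)) else 0) +
        (if i = j then ((P.D 0 0 : ℝ) : ℂ) else 0) := by
  have hA : cmat (P.c2d τ).A = flow (cmat P.A) τ := cmat_exp _ _
  have hjN : ((N - 1 - j : ℕ) : ℝ) = N - 1 - j := by
    have := j.2
    rw [Nat.cast_sub (by omega), Nat.cast_sub (by omega)]; simp
  have hcol : ∀ k : Fin n, cmat ((P.c2d τ).lift N).B k j =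
      (flow (cmat P.A) ((N - 1 - j) * τ) * cmat (P.c2d τ).B) k 0 := by
    intro k
    rw [← hjN, matrix_flow_natMul, ← hA, ← cmat_pow, ← cmat_mul]
    rfl
  have hrow : ∀ k : Fin n, cmat ((P.c2d τ).lift N).C i k =
      (cmat P.C * flow (cmat P.A) (i * τ)) 0 k := by
    intro k
    rw [matrix_flow_natMul, ← hA, ← cmat_pow, ← cmat_mul]
    rfl
  rw [transfer, Matrix.add_apply, add_assoc]
  congr 1
  · simp_rw [matrix_flow_add, ← Matrix.mul_assoc]
    rw [← io_c2d, Matrix.mul_apply]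
    have hinv : (z • (1 : Matrix (Fin n) (Fin n) ℂ) - cmat ((P.c2d τ).lift N).A)⁻¹ =
        Ring.inverse (z • 1 - flow (cmat P.A) (N * τ)) := by
      rw [Matrix.nonsing_inv_eq_ringInverse, matrix_flow_natMul, ← hA, ← cmat_pow]
      rfl
    rw [hinv]
    have e1 : ∀ k : Fin n, (cmat ((P.c2d τ).lift N).C *
        Ring.inverse (z • 1 - flow (cmat P.A) (N * τ))) i k =
        (cmat P.C * flow (cmat P.A) (i * τ) *
          Ring.inverse (z • 1 - flow (cmat P.A) (N * τ))) 0 k := by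
      intro k
      rw [Matrix.mul_apply, Matrix.mul_apply]
      exact Finset.sum_congr rfl fun l _ => by rw [hrow]
    rw [← Matrix.mul_assoc, ← Matrix.mul_assoc, Matrix.mul_assoc _ _ (cmat (P.c2d τ).B), Matrix.mul_apply]
    exact Finset.sum_congr rfl fun k _ => by rw [e1]; exact congrArg _ (hcol k)
  · change ((((if (j : ℕ) = (i : ℕ) then (P.c2d τ).D 0 0
      else if (j : ℕ) < (i : ℕ) then
        ((P.c2d τ).C * (P.c2d τ).A ^ ((i : ℕ) - (j : ℕ) - 1) * (P.c2d τ).B) 0 0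
      else 0 : ℝ)) : ℂ)) = _
    rcases lt_trichotomy (j : ℕ) (i : ℕ) with hij | hij | hij
    · have hne : i ≠ j := fun e => by simp [e] at hij
      rw [if_neg hij.ne, if_pos hij, if_pos hij, if_neg hne, add_zero]
      have hijc : ((i - j - 1 : ℕ) : ℝ) = (i : ℝ) - j - 1 := by
        rw [Nat.cast_sub (by omega), Nat.cast_sub (by omega)]; simp
      simp_rw [matrix_flow_add]
      rw [← io_c2d, ← hijc, matrix_flow_natMul, ← hA, ← cmat_pow, ← cmat_mul, ← cmat_mul]
      rfl
    · have hne : i = j := Fin.ext hij.symm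
      rw [if_pos hij, if_neg hij.not_lt, if_pos hne, zero_add]
      rfl
    · have hne : i ≠ j := fun e => by simp [e] at hij
      rw [if_neg hij.ne', if_neg hij.not_gt, if_neg hij.not_gt, if_neg hne]
      simp

end StateSpace

end Matrices

/-! ### Integral operators on `L²[0, h)` -/

section KernelOperators

/-- The kernels that are jointly measurable on the plane and bounded on `[0, h)²`. -/
def BddKernel (h : ℝ) : Submodule ℂ (ℝ → ℝ → ℂ) where
  carrier := {k | Measurable (Function.uncurry k) ∧
    ∃ C, ∀ t ∈ Ico 0 h, ∀ τ ∈ Ico 0 h, ‖k t τ‖ ≤ C}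
  zero_mem' := ⟨measurable_const, 0, by simp⟩
  add_mem' := by
    rintro k l ⟨hk, C, hC⟩ ⟨hl, D, hD⟩
    exact ⟨hk.add hl, C + D, fun t ht τ hτ =>
      (norm_add_le _ _).trans (add_le_add (hC t ht τ hτ) (hD t ht τ hτ))⟩
  smul_mem' := by
    rintro c k ⟨hk, C, hC⟩
    refine ⟨hk.const_smul c, ‖c‖ * C, fun t ht τ hτ => ?_⟩
    rw [Pi.smul_apply, Pi.smul_apply, norm_smul]
    exact mul_le_mul_of_nonneg_left (hC t ht τ hτ) (norm_nonneg c)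

variable {h : ℝ}

theorem BddKernel.measurable_row {k : ℝ → ℝ → ℂ} (hk : k ∈ BddKernel h) (t : ℝ) :
    Measurable (k t) :=
  hk.1.comp measurable_prodMk_left

theorem ae_mem_Ico (h : ℝ) : ∀ᵐ t ∂(volume.restrict (Ico (0 : ℝ) h)), t ∈ Ico (0 : ℝ) h :=
  ae_restrict_mem measurableSet_Ico

theorem L2.integrable (f : L2 h) : Integrable f (volume.restrict (Ico (0 : ℝ) h)) :=
  (Lp.memLp f).integrable one_le_two

theorem L2.norm_sq_eq (f : L2 h) : ‖f‖ ^ 2 = ∫ τ in Ico 0 h, ‖f τ‖ ^ 2 := by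
  have h1 : inner ℂ f f = ((∫ τ in Ico 0 h, ‖f τ‖ ^ 2 : ℝ) : ℂ) := by
    rw [L2.inner_def, ← integral_complex_ofReal]
    refine integral_congr_ae (Eventually.of_forall fun τ => ?_)
    simp only [inner_self_eq_norm_sq_to_K]
    simp
  rw [← inner_self_eq_norm_sq (𝕜 := ℂ), h1]
  simp

theorem BddKernel.memLp_row {k : ℝ → ℝ → ℂ} (hk : k ∈ BddKernel h) {t : ℝ} (ht : t ∈ Ico 0 h) :
    MemLp (k t) 2 (volume.restrict (Ico (0 : ℝ) h)) := by
  obtain ⟨C, hC⟩ := hk.2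
  refine MemLp.of_bound (BddKernel.measurable_row hk t).aestronglyMeasurable C ?_
  filter_upwards [ae_mem_Ico h] with τ hτ using hC t ht τ hτ

theorem BddKernel.integrable_mul {k : ℝ → ℝ → ℂ} (hk : k ∈ BddKernel h) {t : ℝ}
    (ht : t ∈ Ico 0 h) (f : L2 h) :
    Integrable (fun τ => k t τ * f τ) (volume.restrict (Ico (0 : ℝ) h)) :=
  (BddKernel.memLp_row hk ht).integrable_mul (Lp.memLp f)

/-- The Cauchy-Schwarz inequality for one row of a kernel. -/
theorem norm_kernel_integral_le {k : ℝ → ℝ → ℂ} (hk : k ∈ BddKernel h) {t : ℝ} (ht : t ∈ Ico 0 h)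
    {b : ℝ} (hb : 0 ≤ b) (hrow : ∫ τ in Ico 0 h, ‖k t τ‖ ^ 2 ≤ b ^ 2) (f : L2 h) :
    ‖∫ τ in Ico 0 h, k t τ * f τ‖ ≤ b * ‖f‖ := by
  have hmem : MemLp (fun τ => star (k t τ)) 2 (volume.restrict (Ico (0 : ℝ) h)) :=
    (BddKernel.memLp_row hk ht).star
  set r : L2 h := hmem.toLp with hr
  have h1 : inner ℂ r f = ∫ τ in Ico 0 h, k t τ * f τ := by
    rw [L2.inner_def]
    refine integral_congr_ae ?_
    filter_upwards [hmem.coeFn_toLp] with τ hτ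
    rw [hr, hτ]
    simp [mul_comm]
  have h2 : ‖r‖ ^ 2 = ∫ τ in Ico 0 h, ‖k t τ‖ ^ 2 := by
    rw [L2.norm_sq_eq]
    refine integral_congr_ae ?_
    filter_upwards [hmem.coeFn_toLp] with τ hτ
    rw [hr, hτ, norm_star]
  rw [← h1]
  refine (norm_inner_le_norm r f).trans (mul_le_mul_of_nonneg_right ?_ (norm_nonneg f))
  exact le_of_sq_le_sq (h2.trans_le hrow) hb

theorem BddKernel.exists_row_bound {k : ℝ → ℝ → ℂ} (hk : k ∈ BddKernel h) : ∃ b : ℝ, 0 ≤ b ∧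
    ∀ t ∈ Ico 0 h, ∫ τ in Ico 0 h, ‖k t τ‖ ^ 2 ≤ b ^ 2 := by
  obtain ⟨C, hC⟩ := hk.2
  refine ⟨√(C ^ 2 * volume.real (Ico 0 h)), Real.sqrt_nonneg _, fun t ht => ?_⟩
  rw [Real.sq_sqrt (by positivity)]
  refine (Real.le_norm_self _).trans
    (norm_setIntegral_le_of_norm_le_const measure_Ico_lt_top fun τ hτ => ?_)
  rw [norm_pow, norm_norm]
  exact pow_le_pow_left₀ (norm_nonneg _) (hC t ht τ hτ) 2

theorem BddKernel.memLp_integral {k : ℝ → ℝ → ℂ} (hk : k ∈ BddKernel h) (f : L2 h) :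
    MemLp (fun t => ∫ τ in Ico 0 h, k t τ * f τ) 2 (volume.restrict (Ico (0 : ℝ) h)) := by
  obtain ⟨b, hb, hrow⟩ := BddKernel.exists_row_bound hk
  refine MemLp.of_bound ?_ (b * ‖f‖) ?_
  · have : AEStronglyMeasurable (fun p : ℝ × ℝ => k p.1 p.2 * f p.2)
        ((volume.restrict (Ico (0 : ℝ) h)).prod (volume.restrict (Ico (0 : ℝ) h))) :=
      hk.1.aestronglyMeasurable.mul (Lp.aestronglyMeasurable f).comp_snd
    exact this.integral_prod_right'
  · filter_upwards [ae_mem_Ico h] with t ht using norm_kernel_integral_le hk ht hb (hrow t ht) f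

/-- The integral operator on `L²[0, h)` with a bounded measurable kernel, linear in the kernel. -/
noncomputable def kernelOp (h : ℝ) : BddKernel h →ₗ[ℂ] (L2 h →L[ℂ] L2 h) where
  toFun k := LinearMap.mkContinuousOfExistsBound
    { toFun := fun f => (BddKernel.memLp_integral k.2 f).toLp
      map_add' := by
        intro f g
        refine Lp.ext ?_
        filter_upwards [(BddKernel.memLp_integral k.2 (f + g)).coeFn_toLp,
          Lp.coeFn_add (BddKernel.memLp_integral k.2 f).toLp
            (BddKernel.memLp_integral k.2 g).toLp,
          (BddKernel.memLp_integral k.2 f).coeFn_toLp,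
          (BddKernel.memLp_integral k.2 g).coeFn_toLp, ae_mem_Ico h] with t h1 h2 h3 h4 ht
        rw [h1, h2, Pi.add_apply, h3, h4, ← integral_add (BddKernel.integrable_mul k.2 ht f)
          (BddKernel.integrable_mul k.2 ht g)]
        refine integral_congr_ae ?_
        filter_upwards [Lp.coeFn_add f g] with τ hτ
        rw [hτ, Pi.add_apply, mul_add]
      map_smul' := by
        intro c f
        refine Lp.ext ?_
        filter_upwards [(BddKernel.memLp_integral k.2 (c • f)).coeFn_toLp,
          Lp.coeFn_smul c (BddKernel.memLp_integral k.2 f).toLp,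
          (BddKernel.memLp_integral k.2 f).coeFn_toLp] with t h1 h2 h3
        rw [h1, RingHom.id_apply, h2, Pi.smul_apply, h3, ← integral_smul]
        refine integral_congr_ae ?_
        filter_upwards [Lp.coeFn_smul c f] with τ hτ
        rw [hτ, Pi.smul_apply, smul_eq_mul, smul_eq_mul, mul_left_comm] }
    (by
      obtain ⟨b, hb, hrow⟩ := BddKernel.exists_row_bound k.2
      refine ⟨measureUnivNNReal (volume.restrict (Ico (0 : ℝ) h)) ^ (2 : ENNReal).toReal⁻¹ * b,
        fun f => ?_⟩
      rw [mul_assoc]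
      refine Lp.norm_le_of_ae_bound (by positivity) ?_
      filter_upwards [(BddKernel.memLp_integral k.2 f).coeFn_toLp, ae_mem_Ico h] with t h1 ht
      exact (congrArg norm h1).trans_le (norm_kernel_integral_le k.2 ht hb (hrow t ht) f))
  map_add' := by
    intro k l
    ext1 f
    refine Lp.ext ?_
    filter_upwards [(BddKernel.memLp_integral (k + l).2 f).coeFn_toLp,
      Lp.coeFn_add (BddKernel.memLp_integral k.2 f).toLp
        (BddKernel.memLp_integral l.2 f).toLp,
      (BddKernel.memLp_integral k.2 f).coeFn_toLp,
      (BddKernel.memLp_integral l.2 f).coeFn_toLp, ae_mem_Ico h] with t h1 h2 h3 h4 ht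
    refine h1.trans (Eq.trans ?_ h2.symm)
    rw [Pi.add_apply, h3, h4, ← integral_add (BddKernel.integrable_mul k.2 ht f)
      (BddKernel.integrable_mul l.2 ht f)]
    simp [add_mul]
  map_smul' := by
    intro c k
    ext1 f
    refine Lp.ext ?_
    filter_upwards [(BddKernel.memLp_integral (c • k).2 f).coeFn_toLp,
      Lp.coeFn_smul c (BddKernel.memLp_integral k.2 f).toLp,
      (BddKernel.memLp_integral k.2 f).coeFn_toLp] with t h1 h2 h3
    refine h1.trans (Eq.trans ?_ h2.symm)
    rw [Pi.smul_apply, h3, ← integral_smul]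
    simp [mul_assoc]

theorem kernelOp_apply (k : BddKernel h) (f : L2 h) :
    kernelOp h k f =ᵐ[volume.restrict (Ico (0 : ℝ) h)]
      fun t => ∫ τ in Ico 0 h, (k : ℝ → ℝ → ℂ) t τ * f τ :=
  (BddKernel.memLp_integral k.2 f).coeFn_toLp

/-- Only a uniform bound on the `L²` norms of the rows is used, rather than the smaller
Hilbert-Schmidt norm. -/
theorem norm_kernelOp_le (hh : 0 < h) (k : BddKernel h) {b : ℝ} (hb : 0 ≤ b)
    (hrow : ∀ t ∈ Ico 0 h, ∫ τ in Ico 0 h, ‖(k : ℝ → ℝ → ℂ) t τ‖ ^ 2 ≤ b ^ 2) :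
    ‖kernelOp h k‖ ≤ √h * b := by
  refine ContinuousLinearMap.opNorm_le_bound _ (by positivity) fun f => ?_
  have hvol : ((measureUnivNNReal (volume.restrict (Ico (0 : ℝ) h)) : ℝ)) ^
      (2 : ENNReal).toReal⁻¹ = √h := by
    rw [Real.sqrt_eq_rpow]
    simp [measureUnivNNReal, ENNReal.ofReal, hh.le]
  rw [mul_assoc, ← hvol]
  refine Lp.norm_le_of_ae_bound (by positivity) ?_
  filter_upwards [kernelOp_apply k f, ae_mem_Ico h] with t h1 ht
  exact (congrArg norm h1).trans_le (norm_kernel_integral_le k.2 ht hb (hrow t ht) f)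

end KernelOperators

/-! ### The lifted operators of a state-space system -/

/-- Measurable maps of `[0, h)` to itself, at which the output over one period is observed: the
identity for the lifted system itself, the constant `0` for its sampled output. -/
abbrev OutputTimes (h : ℝ) : Type :=
  {θ : ℝ → ℝ // Measurable θ ∧ MapsTo θ (Ico 0 h) (Ico 0 h)}

/-- Observation at every time. -/
def OutputTimes.all (h : ℝ) : OutputTimes h := ⟨id, measurable_id, mapsTo_id _⟩

/-- Observation at the sampling instants. -/
def OutputTimes.sampling {h : ℝ} (hh : 0 < h) : OutputTimes h :=
  ⟨fun _ => 0, measurable_const, fun _ _ => ⟨le_rfl, hh⟩⟩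

section Response

variable {𝔸 : Type*} [NormedRing 𝔸] [NormedAlgebra ℂ 𝔸]

/-- The impulse response `s ↦ c (exp (s A))` for `s > 0`, extended by zero. -/
noncomputable def impulse (A : 𝔸) (c : 𝔸 →L[ℂ] ℂ) (s : ℝ) : ℂ :=
  if 0 < s then c (flow A s) else 0

/-- The resolvent `(z - exp (h A))⁻¹` of the state transition over one period. For `‖z‖ = 1` it is
a true inverse as soon as the powers of `exp (h A)` are summable, see `hasSum_resolv`. -/
noncomputable def resolv (A : 𝔸) (h : ℝ) (z : ℂ) : 𝔸 := Ring.inverse (z • 1 - flow A h)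

variable [CompleteSpace 𝔸]

section Resolvent

variable {A : 𝔸} {h : ℝ} (hM : Summable fun k : ℕ => ‖flow A h ^ k‖) {z : ℂ} (hz : ‖z‖ = 1)

include hM hz

theorem hasSum_resolv : HasSum (fun k : ℕ => z⁻¹ ^ (k + 1) • flow A h ^ k) (resolv A h z) := by
  have hz0 : z ≠ 0 := by rintro rfl; simp at hz
  have hs : Summable fun k : ℕ => (z⁻¹ • flow A h) ^ k := by
    refine Summable.of_norm ?_
    simpa [smul_pow, norm_smul, hz] using hM
  have h1 := hs.tsum_pow_mul_one_sub
  have h2 := hs.one_sub_mul_tsum_pow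
  have h3 : z • (1 : 𝔸) - flow A h = z • (1 - z⁻¹ • flow A h) := by
    rw [smul_sub, smul_smul, mul_inv_cancel₀ hz0, one_smul]
  set S := ∑' k : ℕ, (z⁻¹ • flow A h) ^ k
  have h4 : resolv A h z = z⁻¹ • S := by
    let u : 𝔸ˣ := ⟨z • (1 - z⁻¹ • flow A h), z⁻¹ • S,
      by rw [smul_mul_smul_comm, mul_inv_cancel₀ hz0, one_smul, h2],
      by rw [smul_mul_smul_comm, inv_mul_cancel₀ hz0, one_smul, h1]⟩
    rw [resolv, h3]
    exact Ring.inverse_unit u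
  rw [h4]
  convert hs.hasSum.const_smul z⁻¹ using 1
  funext k
  rw [smul_pow, smul_smul, pow_succ']

theorem norm_resolv_le : ‖resolv A h z‖ ≤ ∑' k : ℕ, ‖flow A h ^ k‖ := by
  have h1 := hasSum_resolv hM hz
  rw [← h1.tsum_eq]
  refine tsum_of_norm_bounded hM.hasSum fun k => ?_
  rw [norm_smul, norm_pow, norm_inv, hz]
  simp

theorem hasSum_resolv_mul :
    HasSum (fun k : ℕ => z⁻¹ ^ (k + 1) • flow A h ^ (k + 1)) (resolv A h z * flow A h) := by
  have h1 : (fun k : ℕ => z⁻¹ ^ (k + 1) • flow A h ^ (k + 1)) =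
      fun k : ℕ => z⁻¹ ^ (k + 1) • flow A h ^ k * flow A h := by
    funext k
    rw [smul_mul_assoc, pow_succ (flow A h)]
  rw [h1]
  exact (hasSum_resolv hM hz).mul_right (flow A h)

end Resolvent

theorem resolv_commute_flow (A : 𝔸) (h : ℝ) (z : ℂ) (s : ℝ) :
    Commute (resolv A h z) (flow A s) := by
  have : Commute (z • (1 : 𝔸) - flow A h) (flow A s) :=
    ((Commute.one_left _).smul_left z).sub_left (flow_commute A h s)
  rw [resolv]
  by_cases hu : IsUnit (z • (1 : 𝔸) - flow A h)
  · obtain ⟨u, hu⟩ := hu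
    rw [← hu] at this ⊢
    rw [Ring.inverse_unit]
    exact this.units_inv_left
  · rw [Ring.inverse_non_unit _ hu]
    exact Commute.zero_left _

theorem measurable_impulse (A : 𝔸) (c : 𝔸 →L[ℂ] ℂ) : Measurable (impulse A c) :=
  Measurable.ite measurableSet_Ioi (c.continuous.comp (continuous_flow A)).measurable
    measurable_const

theorem impulseKernel_mem (A : 𝔸) (c : 𝔸 →L[ℂ] ℂ) {h : ℝ} (θ : OutputTimes h) (k : ℕ) :
    (fun t τ : ℝ => impulse A c (k * h + θ.1 t - τ)) ∈ BddKernel h := by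
  refine ⟨(measurable_impulse A c).comp
    ((measurable_const.add (θ.2.1.comp measurable_fst)).sub measurable_snd), ?_⟩
  obtain ⟨L, hL0, hL⟩ := exists_flow_bound A ((k + 1) * h)
  refine ⟨‖c‖ * L, fun t ht τ hτ => ?_⟩
  have h1 := θ.2.2 ht
  simp only [impulse]
  split_ifs with hs
  · refine (c.le_opNorm _).trans (mul_le_mul_of_nonneg_left (hL _ ?_) (norm_nonneg c))
    rw [abs_of_pos hs]
    nlinarith [h1.2, hτ.1]
  · simpa using by positivity

theorem flowKernel_mem (A : 𝔸) (c : 𝔸 →L[ℂ] ℂ) {h : ℝ} (θ : OutputTimes h) (X : 𝔸) :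
    (fun t τ : ℝ => c (flow A (θ.1 t - τ) * X)) ∈ BddKernel h := by
  have hcont : Continuous fun s : ℝ => c (flow A s * X) :=
    c.continuous.comp ((continuous_flow A).mul continuous_const)
  refine ⟨hcont.measurable.comp ((θ.2.1.comp measurable_fst).sub measurable_snd), ?_⟩
  obtain ⟨L, hL0, hL⟩ := exists_flow_bound A h
  refine ⟨‖c‖ * (L * ‖X‖), fun t ht τ hτ => ?_⟩
  have h1 := θ.2.2 ht
  refine (c.le_opNorm _).trans (mul_le_mul_of_nonneg_left ((norm_mul_le _ _).trans
    (mul_le_mul_of_nonneg_right (hL _ ?_) (norm_nonneg X))) (norm_nonneg c))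
  rw [abs_le]
  constructor <;> linarith [h1.1, h1.2, hτ.1, hτ.2]

/-- The response over period `k`, observed at the times `θ`, to an input over period `0`. -/
noncomputable def respOp (A : 𝔸) (c : 𝔸 →L[ℂ] ℂ) {h : ℝ} (θ : OutputTimes h) (k : ℕ) :
    L2 h →L[ℂ] L2 h :=
  kernelOp h ⟨_, impulseKernel_mem A c θ k⟩

/-- The operator with the kernel `c (exp ((θ t - τ) A) X)`, linear in `X`. -/
noncomputable def flowOp (A : 𝔸) (c : 𝔸 →L[ℂ] ℂ) {h : ℝ} (θ : OutputTimes h) :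
    𝔸 →ₗ[ℂ] (L2 h →L[ℂ] L2 h) :=
  kernelOp h ∘ₗ
    { toFun := fun X => ⟨_, flowKernel_mem A c θ X⟩
      map_add' := fun X Y => Subtype.ext (by funext t τ; simp [mul_add])
      map_smul' := fun r X => Subtype.ext (by funext t τ; simp) }

/-- The transfer function at `z` of the impulse response `respOp A c θ`. -/
noncomputable def transOp (A : 𝔸) (c : 𝔸 →L[ℂ] ℂ) {h : ℝ} (θ : OutputTimes h) (z : ℂ) :
    L2 h →L[ℂ] L2 h :=
  respOp A c θ 0 + flowOp A c θ (resolv A h z * flow A h)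

theorem kernelOp_congr {h : ℝ} {k l : BddKernel h}
    (hkl : ∀ t ∈ Ico 0 h, ∀ τ ∈ Ico 0 h, (k : ℝ → ℝ → ℂ) t τ = (l : ℝ → ℝ → ℂ) t τ) :
    kernelOp h k = kernelOp h l := by
  ext1 f
  refine Lp.ext ?_
  filter_upwards [kernelOp_apply k f, kernelOp_apply l f, ae_mem_Ico h] with t h1 h2 ht
  rw [h1, h2]
  exact setIntegral_congr_fun measurableSet_Ico fun τ hτ => by simp only [hkl t ht τ hτ]

/-- After the first period the response is the free motion from the state reached. -/
theorem respOp_succ (A : 𝔸) (c : 𝔸 →L[ℂ] ℂ) {h : ℝ} (θ : OutputTimes h) (k : ℕ) :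
    respOp A c θ (k + 1) = flowOp A c θ (flow A h ^ (k + 1)) := by
  refine kernelOp_congr fun t ht τ hτ => ?_
  have h1 := θ.2.2 ht
  have hh : 0 ≤ h := ht.1.trans ht.2.le
  change impulse A c _ = c _
  have hs : 0 < ((k + 1 : ℕ) : ℝ) * h + θ.1 t - τ := by
    push_cast
    have : 0 ≤ (k : ℝ) * h := by positivity
    linarith [h1.1, hτ.2]
  rw [impulse, if_pos hs, ← flow_natMul, ← flow_add]
  congr 2
  ring

variable [FiniteDimensional ℂ 𝔸]

section Sum

variable {A : 𝔸} {h : ℝ} (hM : Summable fun k : ℕ => ‖flow A h ^ k‖) {z : ℂ} (hz : ‖z‖ = 1)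
  (c : 𝔸 →L[ℂ] ℂ) (θ : OutputTimes h)

include hM hz

/-- The geometric series of the state transition, transported by the continuous linear map
`flowOp`. -/
theorem hasSum_respOp : HasSum (fun k : ℕ => z⁻¹ ^ k • respOp A c θ k) (transOp A c θ z) := by
  rw [← hasSum_nat_add_iff' 1]
  have h1 := (hasSum_resolv_mul hM hz).mapL (LinearMap.toContinuousLinearMap (flowOp A c θ))
  convert h1 using 1
  · funext k
    rw [respOp_succ, map_smul]
    rfl
  · simp [transOp]

theorem summable_norm_respOp : Summable fun k : ℕ => ‖z⁻¹ ^ k • respOp A c θ k‖ := by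
  rw [← summable_nat_add_iff 1]
  set Λ := LinearMap.toContinuousLinearMap (flowOp A c θ)
  refine Summable.of_nonneg_of_le (fun k => norm_nonneg _) (fun k => ?_)
    (((summable_nat_add_iff 1).2 hM).mul_left ‖Λ‖)
  rw [norm_smul, norm_pow, norm_inv, hz, inv_one, one_pow, one_mul, respOp_succ]
  exact Λ.le_opNorm _

end Sum

/-- The transfer functions are bounded on the unit circle. -/
theorem exists_transOp_bound {A : 𝔸} {h : ℝ} (hM : Summable fun k : ℕ => ‖flow A h ^ k‖)
    (c : 𝔸 →L[ℂ] ℂ) (θ : OutputTimes h) :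
    ∃ b : ℝ, 0 ≤ b ∧ ∀ z : ℂ, ‖z‖ = 1 → ‖transOp A c θ z‖ ≤ b := by
  set Λ := LinearMap.toContinuousLinearMap (flowOp A c θ)
  refine ⟨‖respOp A c θ 0‖ + ‖Λ‖ * ((∑' k : ℕ, ‖flow A h ^ k‖) * ‖flow A h‖),
    add_nonneg (norm_nonneg _) (by positivity), fun z hz => ?_⟩
  refine (norm_add_le _ _).trans (add_le_add le_rfl ((Λ.le_opNorm _).trans ?_))
  gcongr
  exact (norm_mul_le _ _).trans (mul_le_mul_of_nonneg_right (norm_resolv_le hM hz) (norm_nonneg _))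

end Response

/-! ### Fast discretization of the kernel -/

section Discretization

variable {𝔸 : Type*} [NormedRing 𝔸] [NormedAlgebra ℂ 𝔸]

/-- The kernel of `transOp`: at `(t, τ)` it is the response at time `t` to the impulses of weight
`z⁻ᵏ` at the times `τ - k h`, `k ≥ 0`. -/
noncomputable def transKernel (A : 𝔸) (c : 𝔸 →L[ℂ] ℂ) (h : ℝ) (z : ℂ) (t τ : ℝ) : ℂ :=
  impulse A c (t - τ) + c (flow A (t - τ) * (resolv A h z * flow A h))

/-- The transfer matrix of the strictly proper part of the fast-sampled lifted system, for the
fast sampling period `δ` and `N` samples per period. -/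
noncomputable def fastMatrix (A : 𝔸) (c : 𝔸 →L[ℂ] ℂ) (δ : ℝ) (N : ℕ) (z : ℂ) :
    Matrix (Fin N) (Fin N) ℂ :=
  Matrix.of fun i j =>
    (∫ s in (0 : ℝ)..δ, c (flow A (i * δ) * Ring.inverse (z • 1 - flow A (N * δ)) *
        flow A ((N - 1 - j) * δ + s))) +
      if (j : ℕ) < i then ∫ s in (0 : ℝ)..δ, c (flow A ((i - j - 1) * δ + s)) else 0

theorem norm_average_sub_le {g : ℝ → ℂ} (hg : Continuous g) {δ ε : ℝ} (hδ : 0 < δ) {a : ℂ}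
    (h : ∀ s ∈ Ioc 0 δ, ‖g s - a‖ ≤ ε) : ‖(δ : ℂ)⁻¹ * (∫ s in (0 : ℝ)..δ, g s) - a‖ ≤ ε := by
  have hδ' : (δ : ℂ) ≠ 0 := by exact_mod_cast hδ.ne'
  have h1 : (δ : ℂ)⁻¹ * (∫ s in (0 : ℝ)..δ, g s) - a =
      (δ : ℂ)⁻¹ * ∫ s in (0 : ℝ)..δ, (g s - a) := by
    rw [intervalIntegral.integral_sub (hg.intervalIntegrable _ _)
      (continuous_const.intervalIntegrable _ _), intervalIntegral.integral_const, mul_sub]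
    simp [hδ']
  rw [h1, norm_mul, norm_inv, Complex.norm_real, Real.norm_of_nonneg hδ.le,
    inv_mul_le_iff₀ hδ, mul_comm δ]
  have := intervalIntegral.norm_integral_le_of_norm_le_const (a := 0) (b := δ) (C := ε)
    (f := fun s => g s - a) (by rw [uIoc_of_le hδ.le]; exact h)
  rwa [sub_zero, abs_of_pos hδ] at this

variable [CompleteSpace 𝔸]

/-- On the cell `(i, j)` of the grid of width `h / N`, the rescaled entry of the fast-sampled
transfer matrix is an average of values of the kernel at points at distance at most `2 h / N`, up
to the jump of the kernel on the diagonal cells. -/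
theorem exists_fastMatrix_bound {A : 𝔸} {h : ℝ} (hh : 0 < h)
    (hM : Summable fun k : ℕ => ‖flow A h ^ k‖) (c : 𝔸 →L[ℂ] ℂ) :
    ∃ b : ℝ, 0 ≤ b ∧ ∀ (N : ℕ) (z : ℂ) (i j : Fin N) (t τ : ℝ), ‖z‖ = 1 →
      t ∈ Ico (i * (h / N)) ((i + 1) * (h / N)) → τ ∈ Ico (j * (h / N)) ((j + 1) * (h / N)) →
      ‖((N / h : ℝ) : ℂ) * fastMatrix A c (h / N) N z i j - transKernel A c h z t τ‖ ≤
        b / N + if i = j then b else 0 := by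
  -- the times below are at distance at most `2 h` from points of `[-2 h, 2 h]`
  obtain ⟨L, hL0, hL⟩ := exists_flow_lipschitz A (4 * h)
  obtain ⟨B, hB0, hB⟩ := exists_flow_bound A h
  set S := ∑' k : ℕ, ‖flow A h ^ k‖ with hS
  have hS0 : 0 ≤ S := tsum_nonneg fun k => norm_nonneg _
  set b₁ := ‖c‖ * (L * (2 * h) * S) with hb₁
  set b₂ := ‖c‖ * (L * (2 * h)) with hb₂
  have hb₁0 : 0 ≤ b₁ := by positivity
  have hb₂0 : 0 ≤ b₂ := by positivity
  refine ⟨b₁ + b₂ + ‖c‖ * B, by positivity, fun N z i j t τ hz ht hτ => ?_⟩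
  have hN : 0 < N := i.pos
  have hNr : (0 : ℝ) < N := by exact_mod_cast hN
  set δ := h / N with hδdef
  have hδ : 0 < δ := by positivity
  have hNδ : N * δ = h := by rw [hδdef]; field_simp
  have hδh : δ ≤ h := by rw [← hNδ]; exact le_mul_of_one_le_left hδ.le (by exact_mod_cast hN)
  have hδinv : ((N / h : ℝ) : ℂ) = (δ : ℂ)⁻¹ := by rw [hδdef]; push_cast; rw [inv_div]
  have hcell : ∀ k : Fin N, ((k : ℕ) + 1 : ℝ) * δ ≤ h := by
    intro k
    rw [← hNδ]
    exact mul_le_mul_of_nonneg_right (by exact_mod_cast k.2) hδ.le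
  have ht0 : 0 ≤ t := (by positivity : (0 : ℝ) ≤ i * δ).trans ht.1
  have hτ0 : 0 ≤ τ := (by positivity : (0 : ℝ) ≤ j * δ).trans hτ.1
  have hth : t < h := ht.2.trans_le (hcell i)
  have hτh : τ < h := hτ.2.trans_le (hcell j)
  -- the flow at a node of the grid, compared with the flow in the cell
  have hflow : ∀ s ∈ Ioc 0 δ, ∀ x y : ℝ, |y| ≤ 2 * h →
      x - y = (i * δ - t) + (τ - (j + 1) * δ) + s → ‖flow A x - flow A y‖ ≤ L * (2 * δ) := by
    intro s hs x y hy hxy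
    have h2 : |x - y| ≤ 2 * δ := by
      rw [hxy, abs_le]
      constructor <;> nlinarith [ht.1, ht.2, hτ.1, hτ.2, hs.1, hs.2]
    have h3 : |x| ≤ 4 * h := by
      have := abs_sub_abs_le_abs_sub x y
      linarith
    exact (hL x y h3 (by linarith)).trans (mul_le_mul_of_nonneg_left h2 hL0)
  have hb₁N : b₁ / N = ‖c‖ * (L * (2 * δ) * S) := by rw [hb₁, hδdef]; ring
  have hb₂N : b₂ / N = ‖c‖ * (L * (2 * δ)) := by rw [hb₂, hδdef]; ring
  have hper : ‖(δ : ℂ)⁻¹ * (∫ s in (0 : ℝ)..δ, c (flow A (i * δ) *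
        Ring.inverse (z • 1 - flow A (N * δ)) * flow A ((N - 1 - j) * δ + s))) -
      c (flow A (t - τ) * (resolv A h z * flow A h))‖ ≤ b₁ / N := by
    refine norm_average_sub_le ?_ hδ fun s hs => ?_
    · exact c.continuous.comp (continuous_const.mul
        ((continuous_flow A).comp (continuous_const.add continuous_id)))
    · rw [hNδ, ← resolv, ← map_sub]
      have e1 : flow A (i * δ) * resolv A h z * flow A ((N - 1 - j) * δ + s) -
          flow A (t - τ) * (resolv A h z * flow A h) =
          (flow A (i * δ + ((N - 1 - j) * δ + s)) - flow A (t - τ + h)) * resolv A h z := by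
        rw [mul_assoc, (resolv_commute_flow A h z _).eq, (resolv_commute_flow A h z _).eq,
          ← mul_assoc, ← mul_assoc, ← flow_add, ← flow_add,
          ← sub_mul]
      rw [e1, hb₁N]
      refine (c.le_opNorm _).trans (mul_le_mul_of_nonneg_left ((norm_mul_le _ _).trans
        (mul_le_mul (hflow s hs _ _ ?_ ?_) (norm_resolv_le hM hz) (norm_nonneg _)
          (by positivity))) (norm_nonneg c))
      · rw [abs_le]
        constructor <;> linarith
      · linear_combination hNδ
  have himp : ‖(δ : ℂ)⁻¹ * (if (j : ℕ) < i then
        ∫ s in (0 : ℝ)..δ, c (flow A ((i - j - 1) * δ + s)) else 0) - impulse A c (t - τ)‖ ≤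
      b₂ / N + if i = j then ‖c‖ * B else 0 := by
    rcases lt_trichotomy (j : ℕ) (i : ℕ) with hij | hij | hij
    · have hne : i ≠ j := fun e => by simp [e] at hij
      have hij' : ((j : ℕ) + 1 : ℝ) ≤ (i : ℕ) := by exact_mod_cast hij
      have hlt : 0 < t - τ := by nlinarith [ht.1, hτ.2]
      rw [if_pos hij, if_neg hne, add_zero, impulse, if_pos hlt]
      refine norm_average_sub_le ?_ hδ fun s hs => ?_
      · exact c.continuous.comp
          ((continuous_flow A).comp (continuous_const.add continuous_id))
      · rw [← map_sub, hb₂N]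
        refine (c.le_opNorm _).trans (mul_le_mul_of_nonneg_left (hflow s hs _ _ ?_ ?_)
          (norm_nonneg c))
        · rw [abs_le]
          constructor <;> linarith
        · ring
    · -- a diagonal cell: the jump of the kernel is not resolved by the grid
      have hne : i = j := Fin.ext hij.symm
      rw [if_neg hij.not_lt, if_pos hne, mul_zero, zero_sub, norm_neg, impulse]
      have hb : ‖c‖ * B ≤ b₂ / N + ‖c‖ * B := le_add_of_nonneg_left (by positivity)
      split_ifs
      · refine ((c.le_opNorm _).trans (mul_le_mul_of_nonneg_left (hB _ ?_)
          (norm_nonneg c))).trans hb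
        rw [abs_le]
        constructor <;> linarith
      · rw [norm_zero]
        positivity
    · have hne : i ≠ j := fun e => by simp [e] at hij
      have hij' : ((i : ℕ) + 1 : ℝ) ≤ (j : ℕ) := by exact_mod_cast hij
      have hlt : ¬ 0 < t - τ := by nlinarith [ht.2, hτ.1]
      rw [if_neg hij.not_gt, if_neg hne, impulse, if_neg hlt]
      simp only [mul_zero, sub_zero, norm_zero, add_zero]
      positivity
  have hsplit : ((N / h : ℝ) : ℂ) * fastMatrix A c δ N z i j - transKernel A c h z t τ =
      ((δ : ℂ)⁻¹ * (∫ s in (0 : ℝ)..δ, c (flow A (i * δ) *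
        Ring.inverse (z • 1 - flow A (N * δ)) * flow A ((N - 1 - j) * δ + s))) -
      c (flow A (t - τ) * (resolv A h z * flow A h))) +
      ((δ : ℂ)⁻¹ * (if (j : ℕ) < i then
        ∫ s in (0 : ℝ)..δ, c (flow A ((i - j - 1) * δ + s)) else 0) - impulse A c (t - τ)) := by
    rw [hδinv, fastMatrix, transKernel, Matrix.of_apply]
    ring
  rw [hsplit]
  refine ((norm_add_le _ _).trans (add_le_add hper himp)).trans ?_
  have h1 : b₁ / N + b₂ / N ≤ (b₁ + b₂ + ‖c‖ * B) / N := by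
    rw [← add_div]
    exact div_le_div_of_nonneg_right (le_add_of_nonneg_right (by positivity)) hNr.le
  have h2 : (if i = j then ‖c‖ * B else 0) ≤ if i = j then b₁ + b₂ + ‖c‖ * B else 0 := by
    split_ifs
    · linarith
    · exact le_rfl
  linarith

end Discretization

/-! ### Step functions -/

section StepFunctions

/-- The index of the cell of the grid of width `h / N` on `[0, h)` that contains `t`; outside
`[0, h)`, where the reduction modulo `N` takes effect, the value is irrelevant. -/
noncomputable def cell (h : ℝ) (N : ℕ) [NeZero N] (t : ℝ) : Fin N := Fin.ofNat N ⌊t * N / h⌋₊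

variable {h : ℝ} {N : ℕ} [NeZero N]

theorem measurable_cell : Measurable (cell h N) :=
  (measurable_from_nat (f := Fin.ofNat N)).comp
    (Nat.measurable_floor.comp ((measurable_id.mul_const _).div_const _))

theorem cell_eq_iff (hh : 0 < h) {t : ℝ} (ht : t ∈ Ico 0 h) (i : Fin N) :
    cell h N t = i ↔ t ∈ Ico (i * (h / N)) ((i + 1) * (h / N)) := by
  have hN : (0 : ℝ) < N := by exact_mod_cast Nat.pos_of_neZero N
  have h0 : 0 ≤ t * N / h := div_nonneg (mul_nonneg ht.1 hN.le) hh.le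
  have hlt : ⌊t * N / h⌋₊ < N := by
    rw [Nat.floor_lt h0, div_lt_iff₀ hh, mul_comm]
    exact mul_lt_mul_of_pos_left ht.2 hN
  rw [cell, Fin.ext_iff, Fin.val_ofNat, Nat.mod_eq_of_lt hlt, Nat.floor_eq_iff h0, mem_Ico,
    le_div_iff₀ hh, div_lt_iff₀ hh, ← mul_div_assoc, ← mul_div_assoc, div_le_iff₀ hN,
    lt_div_iff₀ hN]

theorem cell_mem (hh : 0 < h) {t : ℝ} (ht : t ∈ Ico 0 h) :
    t ∈ Ico ((cell h N t : ℕ) * (h / N)) (((cell h N t : ℕ) + 1) * (h / N)) :=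
  (cell_eq_iff hh ht _).1 rfl

theorem volume_cell (hh : 0 < h) (i : Fin N) :
    volume.restrict (Ico (0 : ℝ) h) (cell h N ⁻¹' {i}) = ENNReal.ofReal (h / N) := by
  have hN : (0 : ℝ) < N := by exact_mod_cast Nat.pos_of_neZero N
  rw [Measure.restrict_apply (measurable_cell (measurableSet_singleton i))]
  have : cell h N ⁻¹' {i} ∩ Ico 0 h = Ico (i * (h / N)) ((i + 1) * (h / N)) := by
    ext t
    constructor
    · rintro ⟨h1, h2⟩
      exact (cell_eq_iff hh h2 i).1 h1
    · intro h1
      have h2 : t ∈ Ico 0 h := by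
        refine ⟨(by positivity : (0 : ℝ) ≤ i * (h / N)).trans h1.1, h1.2.trans_le ?_⟩
        rw [← mul_div_assoc, div_le_iff₀ hN, mul_comm]
        exact mul_le_mul_of_nonneg_left (by exact_mod_cast i.2) hh.le
      exact ⟨(cell_eq_iff hh h2 i).2 h1, h2⟩
  rw [this, Real.volume_Ico]
  ring_nf

theorem integral_cell {E : Type*} [NormedAddCommGroup E] [NormedSpace ℝ E] [CompleteSpace E]
    (hh : 0 < h) (g : Fin N → E) :
    ∫ t in Ico 0 h, g (cell h N t) = (h / N) • ∑ i, g i := by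
  have hfin : IsFiniteMeasure ((volume.restrict (Ico (0 : ℝ) h)).map (cell h N)) :=
    Measure.isFiniteMeasure_map _ _
  rw [← integral_map (φ := cell h N) measurable_cell.aemeasurable
    StronglyMeasurable.of_discrete.aestronglyMeasurable,
    integral_fintype Integrable.of_finite, Finset.smul_sum]
  refine Finset.sum_congr rfl fun i _ => ?_
  rw [measureReal_def, Measure.map_apply measurable_cell (measurableSet_singleton i),
    volume_cell hh, ENNReal.toReal_ofReal (by positivity)]

/-- The step function with the value `√(N / h) v i` on cell `i`; the factor makes the embedding
isometric. -/
noncomputable def stepFun (h : ℝ) (N : ℕ) [NeZero N] (v : EuclideanSpace ℂ (Fin N)) (t : ℝ) : ℂ :=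
  (√(N / h) : ℂ) * v (cell h N t)

theorem memLp_stepFun (v : EuclideanSpace ℂ (Fin N)) :
    MemLp (stepFun h N v) 2 (volume.restrict (Ico (0 : ℝ) h)) := by
  refine MemLp.of_bound (C := ‖(√(N / h) : ℂ)‖ * ‖v‖)
    (((Measurable.of_discrete (f := fun i : Fin N => v i)).comp
      measurable_cell).const_mul _).aestronglyMeasurable (Eventually.of_forall fun t => ?_)
  rw [stepFun, norm_mul]
  exact mul_le_mul_of_nonneg_left (PiLp.norm_apply_le v _) (norm_nonneg _)

/-- The isometric embedding of `ℂᴺ` into `L²[0, h)` as the step functions. -/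
noncomputable def stepEmb {h : ℝ} (hh : 0 < h) (N : ℕ) [NeZero N] :
    EuclideanSpace ℂ (Fin N) →ₗᵢ[ℂ] L2 h where
  toFun v := (memLp_stepFun v).toLp
  map_add' v w := by
    rw [← MemLp.toLp_add]
    congr 1
    funext t
    simp [stepFun, mul_add]
  map_smul' r v := by
    rw [RingHom.id_apply, ← MemLp.toLp_const_smul]
    congr 1
    funext t
    simp [stepFun, mul_left_comm]
  norm_map' v := by
    have hN : (0 : ℝ) < N := by exact_mod_cast Nat.pos_of_neZero N
    have h1 : ‖(memLp_stepFun (h := h) v).toLp‖ ^ 2 = ‖v‖ ^ 2 := by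
      rw [L2.norm_sq_eq, EuclideanSpace.norm_sq_eq]
      have h2 : ∫ τ in Ico 0 h, ‖MemLp.toLp _ (memLp_stepFun (h := h) v) τ‖ ^ 2 =
          ∫ τ in Ico 0 h, (fun i => N / h * ‖v i‖ ^ 2) (cell h N τ) := by
        refine integral_congr_ae ?_
        filter_upwards [(memLp_stepFun (h := h) v).coeFn_toLp] with τ hτ
        rw [hτ, stepFun, norm_mul, mul_pow, Complex.norm_real,
          Real.norm_of_nonneg (Real.sqrt_nonneg _), Real.sq_sqrt (by positivity)]
      rw [h2, integral_cell hh fun i => N / h * ‖v i‖ ^ 2, ← Finset.mul_sum, smul_eq_mul, ← mul_assoc]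
      field_simp
    exact (sq_eq_sq₀ (norm_nonneg _) (norm_nonneg _)).1 h1

theorem stepEmb_apply (hh : 0 < h) (v : EuclideanSpace ℂ (Fin N)) :
    stepEmb hh N v =ᵐ[volume.restrict (Ico (0 : ℝ) h)] stepFun h N v :=
  (memLp_stepFun v).coeFn_toLp

theorem adjoint_stepEmb_apply (hh : 0 < h) (f : L2 h) (i : Fin N) :
    (stepEmb hh N).toContinuousLinearMap.adjoint f i =
      (√(N / h) : ℂ) * ∫ τ in Ico 0 h, (if cell h N τ = i then 1 else 0) * f τ := by
  have h1 := ContinuousLinearMap.adjoint_inner_right (stepEmb hh N).toContinuousLinearMap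
    (EuclideanSpace.single i (1 : ℂ)) f
  rw [EuclideanSpace.inner_single_left, map_one, one_mul] at h1
  rw [h1, L2.inner_def, ← integral_const_mul]
  refine integral_congr_ae ?_
  filter_upwards [stepEmb_apply hh (EuclideanSpace.single i (1 : ℂ))] with τ hτ
  change inner ℂ (stepEmb hh N (EuclideanSpace.single i (1 : ℂ)) τ) (f τ) = _
  rw [hτ, stepFun]
  by_cases hc : cell h N τ = i <;> simp [hc, mul_comm]

/-- A matrix as an operator on the step functions, extended by zero to the orthogonal complement. -/
noncomputable def stepOp (hh : 0 < h) (M : Matrix (Fin N) (Fin N) ℂ) : L2 h →L[ℂ] L2 h :=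
  (stepEmb hh N).toContinuousLinearMap ∘L Matrix.toEuclideanCLM (𝕜 := ℂ) M ∘L
    (stepEmb hh N).toContinuousLinearMap.adjoint

theorem adjoint_stepEmb_comp (hh : 0 < h) :
    (stepEmb hh N).toContinuousLinearMap.adjoint ∘L (stepEmb hh N).toContinuousLinearMap =
      ContinuousLinearMap.id ℂ (EuclideanSpace ℂ (Fin N)) :=
  (ContinuousLinearMap.norm_map_iff_adjoint_comp_self _).1 (stepEmb hh N).norm_map

theorem norm_stepEmb_le (hh : 0 < h) : ‖(stepEmb hh N).toContinuousLinearMap‖ ≤ 1 :=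
  (stepEmb hh N).norm_toContinuousLinearMap_le

/-- The adjoint of the isometry `stepEmb` is a left inverse of it, so conjugation by it preserves
the norm. -/
theorem norm_stepOp (hh : 0 < h) (M : Matrix (Fin N) (Fin N) ℂ) : ‖stepOp hh M‖ = matNorm M := by
  set J := (stepEmb hh N).toContinuousLinearMap with hJ
  have hJ1 : ‖J‖ ≤ 1 := norm_stepEmb_le hh
  have hJ2 : ‖J.adjoint‖ ≤ 1 := by rwa [LinearIsometryEquiv.norm_map]
  apply le_antisymm
  · calc ‖J ∘L Matrix.toEuclideanCLM (𝕜 := ℂ) M ∘L J.adjoint‖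
        ≤ ‖J‖ * (‖Matrix.toEuclideanCLM (𝕜 := ℂ) M‖ * ‖J.adjoint‖) :=
          (ContinuousLinearMap.opNorm_comp_le _ _).trans
            (mul_le_mul_of_nonneg_left (ContinuousLinearMap.opNorm_comp_le _ _) (norm_nonneg _))
      _ ≤ 1 * (matNorm M * 1) := by
          refine mul_le_mul hJ1 (mul_le_mul_of_nonneg_left hJ2 (norm_nonneg _)) (by positivity)
            zero_le_one
      _ = matNorm M := by ring
  · have h1 : Matrix.toEuclideanCLM (𝕜 := ℂ) M = J.adjoint ∘L stepOp hh M ∘L J := by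
      have h2 : J.adjoint ∘L J = _ := adjoint_stepEmb_comp hh
      ext1 v
      have h3 : ∀ w, J.adjoint (J w) = w := fun w => DFunLike.congr_fun h2 w
      simp only [stepOp, ← hJ, ContinuousLinearMap.comp_apply, h3]
    calc matNorm M = ‖J.adjoint ∘L stepOp hh M ∘L J‖ := by rw [matNorm, h1]
      _ ≤ ‖J.adjoint‖ * (‖stepOp hh M‖ * ‖J‖) :=
          (ContinuousLinearMap.opNorm_comp_le _ _).trans
            (mul_le_mul_of_nonneg_left (ContinuousLinearMap.opNorm_comp_le _ _) (norm_nonneg _))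
      _ ≤ 1 * (‖stepOp hh M‖ * 1) := by
          refine mul_le_mul hJ2 (mul_le_mul_of_nonneg_left hJ1 (norm_nonneg _)) (by positivity)
            zero_le_one
      _ = ‖stepOp hh M‖ := by ring

theorem stepOp_mul (hh : 0 < h) (M M' : Matrix (Fin N) (Fin N) ℂ) :
    stepOp hh (M * M') = stepOp hh M * stepOp hh M' := by
  ext1 f
  have h3 : ∀ w, (stepEmb hh N).toContinuousLinearMap.adjoint
      ((stepEmb hh N).toContinuousLinearMap w) = w :=
    fun w => DFunLike.congr_fun (adjoint_stepEmb_comp hh) w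
  simp only [stepOp, ContinuousLinearMap.comp_apply, mul_apply_eq_comp, h3, map_mul]

theorem stepOp_add (hh : 0 < h) (M M' : Matrix (Fin N) (Fin N) ℂ) :
    stepOp hh (M + M') = stepOp hh M + stepOp hh M' := by
  simp only [stepOp, map_add, ContinuousLinearMap.add_comp, ContinuousLinearMap.comp_add]

theorem stepOp_smul (hh : 0 < h) (r : ℂ) (M : Matrix (Fin N) (Fin N) ℂ) :
    stepOp hh (r • M) = r • stepOp hh M := by
  simp only [stepOp, map_smul, ContinuousLinearMap.smul_comp, ContinuousLinearMap.comp_smul]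

theorem stepKernel_mem (M : Matrix (Fin N) (Fin N) ℂ) {θ : ℝ → ℝ} (hθ : Measurable θ) :
    (fun t τ : ℝ => ((N / h : ℝ) : ℂ) * M (cell h N (θ t)) (cell h N τ)) ∈ BddKernel h := by
  refine ⟨?_, ‖((N / h : ℝ) : ℂ)‖ * ∑ i, ∑ j, ‖M i j‖, fun t _ τ _ => ?_⟩
  · exact ((Measurable.of_discrete (f := fun p : Fin N × Fin N => M p.1 p.2)).comp
      ((measurable_cell.comp (hθ.comp measurable_fst)).prodMk
        (measurable_cell.comp measurable_snd))).const_mul _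
  · rw [norm_mul]
    refine mul_le_mul_of_nonneg_left ?_ (norm_nonneg _)
    exact (Finset.single_le_sum (f := fun j => ‖M (cell h N (θ t)) j‖)
      (fun j _ => norm_nonneg _) (Finset.mem_univ _)).trans
      (Finset.single_le_sum (f := fun i => ∑ j, ‖M i j‖)
        (fun i _ => Finset.sum_nonneg fun j _ => norm_nonneg _) (Finset.mem_univ _))

/-- The factor `N / h` is the product of the two normalizing factors `√(N / h)` of the isometry and
its adjoint. -/
theorem stepOp_eq_kernelOp (hh : 0 < h) (M : Matrix (Fin N) (Fin N) ℂ) :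
    stepOp hh M = kernelOp h ⟨_, stepKernel_mem M measurable_id⟩ := by
  ext1 f
  refine Lp.ext ?_
  set v := (stepEmb hh N).toContinuousLinearMap.adjoint f with hv
  filter_upwards [stepEmb_apply hh (Matrix.toEuclideanCLM (𝕜 := ℂ) M v),
    kernelOp_apply ⟨_, stepKernel_mem M measurable_id⟩ f] with t h1 h2
  rw [h2]
  change stepEmb hh N (Matrix.toEuclideanCLM (𝕜 := ℂ) M v) t = _
  have hint : ∀ j : Fin N, Integrable (fun τ => (if cell h N τ = j then 1 else 0) * f τ)
      (volume.restrict (Ico (0 : ℝ) h)) := by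
    intro j
    refine (L2.integrable f).bdd_mul (c := 1) ?_ (Eventually.of_forall fun τ => ?_)
    · exact (Measurable.ite (measurable_cell (measurableSet_singleton j)) measurable_const
        measurable_const).aestronglyMeasurable
    · split_ifs <;> simp
  have hsq : (√(N / h) : ℂ) * (√(N / h) : ℂ) = ((N / h : ℝ) : ℂ) := by
    rw [← Complex.ofReal_mul, Real.mul_self_sqrt (by positivity)]
  rw [h1, stepFun, Matrix.ofLp_toEuclideanCLM, Matrix.mulVec, dotProduct, Finset.mul_sum]
  simp_rw [hv, adjoint_stepEmb_apply hh]
  calc ∑ j, (√(N / h) : ℂ) * (M (cell h N t) j *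
        ((√(N / h) : ℂ) * ∫ τ in Ico 0 h, (if cell h N τ = j then 1 else 0) * f τ))
      = ∑ j, ∫ τ in Ico 0 h, ((N / h : ℝ) : ℂ) * M (cell h N t) j *
          ((if cell h N τ = j then 1 else 0) * f τ) := by
        refine Finset.sum_congr rfl fun j _ => ?_
        rw [integral_const_mul, ← hsq]
        ring
    _ = ∫ τ in Ico 0 h, ∑ j, ((N / h : ℝ) : ℂ) * M (cell h N t) j *
          ((if cell h N τ = j then 1 else 0) * f τ) :=
        (integral_finsetSum _ fun j _ => (hint j).const_mul _).symm
    _ = _ := by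
        refine integral_congr_ae (Eventually.of_forall fun τ => ?_)
        simp

end StepFunctions

/-! ### Operator-norm convergence of the fast discretization -/

section Convergence

variable {𝔸 : Type*} [NormedRing 𝔸] [NormedAlgebra ℂ 𝔸] [CompleteSpace 𝔸]

/-- The fast-sampled transfer matrix as an operator on `L²[0, h)`, observed at the times `θ`. -/
noncomputable def fastOp (A : 𝔸) (c : 𝔸 →L[ℂ] ℂ) {h : ℝ} (θ : OutputTimes h) (N : ℕ) [NeZero N]
    (z : ℂ) : L2 h →L[ℂ] L2 h :=
  kernelOp h ⟨_, stepKernel_mem (fastMatrix A c (h / N) N z) θ.2.1⟩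

/-- The fast discretization converges in the operator norm, uniformly on the unit circle: in each
row its kernel is off by `O(1)` on one cell, of length `h / N`, and by `O(1 / N)` elsewhere. -/
theorem exists_norm_fastOp_sub_le {A : 𝔸} {h : ℝ} (hh : 0 < h)
    (hM : Summable fun k : ℕ => ‖flow A h ^ k‖) (c : 𝔸 →L[ℂ] ℂ) (θ : OutputTimes h) :
    ∃ b : ℝ, 0 ≤ b ∧ ∀ (N : ℕ) [NeZero N] (z : ℂ), ‖z‖ = 1 →
      ‖fastOp A c θ N z - transOp A c θ z‖ ≤ b / √N := by
  obtain ⟨b, hb0, hb⟩ := exists_fastMatrix_bound hh hM c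
  refine ⟨2 * b * h, by positivity, fun N _ z hz => ?_⟩
  have hN : (0 : ℝ) < N := by exact_mod_cast Nat.pos_of_neZero N
  have hN1 : (1 : ℝ) ≤ N := by exact_mod_cast Nat.pos_of_neZero N
  rw [transOp, respOp, flowOp, fastOp, LinearMap.comp_apply, ← map_add, ← map_sub]
  refine (norm_kernelOp_le hh _ (b := 2 * b * √(h / N)) (by positivity)
    fun t ht => ?_).trans_eq ?_
  · obtain ⟨g, hg⟩ : ∃ g : Fin N → ℝ, g = fun i => 2 * (b / N) ^ 2 +
        if cell h N (θ.1 t) = i then 2 * b ^ 2 else 0 := ⟨_, rfl⟩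
    have hpt : ∀ τ ∈ Ico 0 h, ‖((N / h : ℝ) : ℂ) *
        fastMatrix A c (h / N) N z (cell h N (θ.1 t)) (cell h N τ) -
          (impulse A c ((0 : ℕ) * h + θ.1 t - τ) +
            c (flow A (θ.1 t - τ) * (resolv A h z * flow A h)))‖ ^ 2 ≤
        g (cell h N τ) := by
      intro τ hτ
      have h1 := hb N z (cell h N (θ.1 t)) (cell h N τ) (θ.1 t) τ hz (cell_mem hh (θ.2.2 ht))
        (cell_mem hh hτ)
      rw [Nat.cast_zero, zero_mul, zero_add]
      refine (pow_le_pow_left₀ (norm_nonneg _) h1 2).trans ?_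
      rw [hg]
      dsimp only
      split_ifs
      · nlinarith [sq_nonneg (b / N - b)]
      · nlinarith [sq_nonneg (b / N)]
    have hint : Integrable (fun τ => g (cell h N τ)) (volume.restrict (Ico (0 : ℝ) h)) := by
      refine Integrable.of_bound (C := ∑ i, ‖g i‖)
        ((Measurable.of_discrete (f := g)).comp measurable_cell).aestronglyMeasurable
        (Eventually.of_forall fun τ => ?_)
      exact Finset.single_le_sum (f := fun i => ‖g i‖) (fun i _ => norm_nonneg _)
        (Finset.mem_univ _)
    have hle := integral_mono_of_nonneg (Eventually.of_forall fun τ => sq_nonneg _) hint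
      ((ae_mem_Ico h).mono hpt)
    refine hle.trans ?_
    rw [integral_cell hh g, hg, Finset.sum_add_distrib, Finset.sum_const,
      Finset.sum_ite_eq, if_pos (Finset.mem_univ _), Finset.card_univ, Fintype.card_fin,
      nsmul_eq_mul, smul_eq_mul, mul_pow, Real.sq_sqrt (by positivity), mul_comm]
    refine mul_le_mul_of_nonneg_right ?_ (by positivity)
    have h2 : (N : ℝ) * (2 * (b / N) ^ 2) = 2 * b ^ 2 / N := by field_simp
    have h3 : 2 * b ^ 2 / N ≤ 2 * b ^ 2 := div_le_self (by positivity) hN1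
    rw [h2]
    linarith
  · rw [Real.sqrt_div hh.le]
    have := Real.mul_self_sqrt hh.le
    calc √h * (2 * b * (√h / √N)) = 2 * b * (√h * √h) / √N := by ring
      _ = _ := by rw [this]

end Convergence

/-! ### Operators of a state-space system -/

namespace StateSpace

section

variable {n : ℕ} (P : StateSpace n 1 1) {h : ℝ}

/-- The impulse response of the strictly proper part, extended by zero to negative times. -/
noncomputable def impulseResponse (s : ℝ) : ℂ :=
  if 0 < s then (((P.C * NormedSpace.exp (s • P.A) * P.B) 0 0 : ℝ) : ℂ) else 0

attribute [local instance] Matrix.linftyOpNormedRing Matrix.linftyOpNormedAlgebra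

/-- The response of the strictly proper part over period `k` to an input over period `0`. -/
noncomputable def respOp (θ : OutputTimes h) (k : ℕ) : L2 h →L[ℂ] L2 h :=
  SampledData.respOp (cmat P.A) P.io θ k

/-- The transfer function of the lifted strictly proper part. -/
noncomputable def transOp (θ : OutputTimes h) (z : ℂ) : L2 h →L[ℂ] L2 h :=
  SampledData.transOp (cmat P.A) P.io θ z

/-- The transfer matrix of the fast-sampled lifted strictly proper part. -/
noncomputable def fastMatrix (δ : ℝ) (N : ℕ) (z : ℂ) : Matrix (Fin N) (Fin N) ℂ :=
  SampledData.fastMatrix (cmat P.A) P.io δ N z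

variable {P}

theorem IsHurwitz.summable_norm_flow_pow (hP : P.IsHurwitz) (hh : 0 < h) :
    Summable fun k : ℕ => ‖flow (cmat P.A) h ^ k‖ :=
  summable_norm_pow_of_spectrum fun _ hμ => hP.norm_lt_one_of_mem_spectrum hh hμ

theorem IsHurwitz.hasSum_respOp (hP : P.IsHurwitz) (hh : 0 < h) {z : ℂ} (hz : ‖z‖ = 1)
    (θ : OutputTimes h) : HasSum (fun k : ℕ => z⁻¹ ^ k • P.respOp θ k) (P.transOp θ z) :=
  SampledData.hasSum_respOp (hP.summable_norm_flow_pow hh) hz P.io θ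

theorem IsHurwitz.summable_norm_respOp (hP : P.IsHurwitz) (hh : 0 < h) {z : ℂ} (hz : ‖z‖ = 1)
    (θ : OutputTimes h) : Summable fun k : ℕ => ‖z⁻¹ ^ k • P.respOp θ k‖ :=
  SampledData.summable_norm_respOp (hP.summable_norm_flow_pow hh) hz P.io θ

theorem IsHurwitz.exists_transOp_bound (hP : P.IsHurwitz) (hh : 0 < h) (θ : OutputTimes h) :
    ∃ b : ℝ, 0 ≤ b ∧ ∀ z : ℂ, ‖z‖ = 1 → ‖P.transOp θ z‖ ≤ b :=
  SampledData.exists_transOp_bound (hP.summable_norm_flow_pow hh) P.io θ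

theorem IsHurwitz.exists_norm_kernelOp_sub_le (hP : P.IsHurwitz) (hh : 0 < h)
    (θ : OutputTimes h) :
    ∃ b : ℝ, 0 ≤ b ∧ ∀ (N : ℕ) [NeZero N] (z : ℂ), ‖z‖ = 1 →
      ‖kernelOp h ⟨_, stepKernel_mem (P.fastMatrix (h / N) N z) θ.2.1⟩ - P.transOp θ z‖ ≤
        b / √N :=
  SampledData.exists_norm_fastOp_sub_le hh (hP.summable_norm_flow_pow hh) P.io θ

variable (P)

theorem impulseResponse_eq : P.impulseResponse = impulse (cmat P.A) P.io := by
  funext s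
  rw [impulseResponse, ofReal_impulse]
  rfl

theorem impulseResponseKernel_mem (θ : OutputTimes h) (k : ℕ) :
    (fun t τ : ℝ => P.impulseResponse (k * h + θ.1 t - τ)) ∈ BddKernel h := by
  rw [impulseResponse_eq]
  exact impulseKernel_mem (cmat P.A) P.io θ k

theorem respOp_apply (θ : OutputTimes h) (k : ℕ) (f : L2 h) :
    P.respOp θ k f =ᵐ[volume.restrict (Ico (0 : ℝ) h)]
      fun t => ∫ τ in Ico 0 h, P.impulseResponse (k * h + θ.1 t - τ) * f τ := by
  rw [impulseResponse_eq]
  exact kernelOp_apply ⟨_, impulseKernel_mem (cmat P.A) P.io θ k⟩ f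

theorem transfer_lift_c2d_eq (δ : ℝ) (N : ℕ) (z : ℂ) :
    ((P.c2d δ).lift N).transfer z = P.fastMatrix δ N z + ((P.D 0 0 : ℝ) : ℂ) • 1 := by
  ext i j
  rw [transfer_lift_c2d, Matrix.add_apply, Matrix.smul_apply, Matrix.one_apply, smul_ite,
    smul_zero, smul_eq_mul, mul_one]
  rfl

end

end StateSpace

/-! ### The error system -/

section ErrorOperator

variable {a b : ℕ} (G : StateSpace a 1 1) (F : StateSpace b 1 1) {h : ℝ} (hh : 0 < h) (m : ℕ)

/-- The value at `z` of the transfer function of the lifted error system. -/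
noncomputable def errorOp (K : ℕ → ℝ) (z : ℂ) : L2 h →L[ℂ] L2 h :=
  z⁻¹ ^ m • ((G.transOp (OutputTimes.all h) z + ((G.D 0 0 : ℝ) : ℂ) • 1) *
      F.transOp (OutputTimes.all h) z) -
    filterTransfer K z • F.transOp (OutputTimes.sampling hh) z

variable {G F m}

theorem cell_zero (h : ℝ) (N : ℕ) [NeZero N] : cell h N 0 = 0 := by
  rw [cell, zero_mul, zero_div, Nat.floor_zero]
  rfl

/-- Hold after sampling keeps only the first row of a matrix, that is, the output at time `0`. -/
theorem stepOp_hold_sample (N : ℕ) [NeZero N] (M : Matrix (Fin N) (Fin N) ℂ) :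
    stepOp hh (holdVec N * sampleVec N * M) =
      kernelOp h ⟨_, stepKernel_mem M (OutputTimes.sampling hh).2.1⟩ := by
  rw [stepOp_eq_kernelOp]
  refine kernelOp_congr fun t _ τ _ => ?_
  have h1 : ∀ i j : Fin N, (holdVec N * sampleVec N * M) i j = M 0 j := by
    intro i j
    have h2 : ∀ k : Fin N, (holdVec N * sampleVec N) i k = if k = 0 then 1 else 0 := by
      intro k
      rw [Matrix.mul_apply]
      change ∑ _ : Fin 1, (1 : ℂ) * (if (k : ℕ) = 0 then 1 else 0) = _
      simp only [Finset.univ_unique, Finset.sum_singleton, one_mul, Fin.val_eq_zero_iff]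
    rw [Matrix.mul_apply]
    simp only [h2, ite_mul, one_mul, zero_mul, Finset.sum_ite_eq', Finset.mem_univ, if_true]
  change ((N / h : ℝ) : ℂ) * _ = ((N / h : ℝ) : ℂ) * M (cell h N 0) _
  rw [h1, cell_zero]

/-- The norm of the fast approximation converges to the norm of the error operator, at a rate that
depends on the filter only through the modulus of its transfer function. -/
theorem exists_abs_matNorm_sub_le (hG : G.IsHurwitz) (hF : F.IsHurwitz)
    (hF' : F.IsStrictlyProper) (m : ℕ) :
    ∃ C : ℝ, 0 ≤ C ∧ ∀ (N : ℕ) (K : ℕ → ℝ) (z : ℂ), 0 < N → ‖z‖ = 1 →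
      |matNorm (fastApprox G F h m K N z) - ‖errorOp G F hh m K z‖| ≤
        C * (1 + ‖filterTransfer K z‖) / √N := by
  obtain ⟨bG, hbG0, hbG⟩ := hG.exists_norm_kernelOp_sub_le hh (OutputTimes.all h)
  obtain ⟨bF, hbF0, hbF⟩ := hF.exists_norm_kernelOp_sub_le hh (OutputTimes.all h)
  obtain ⟨bS, hbS0, hbS⟩ := hF.exists_norm_kernelOp_sub_le hh (OutputTimes.sampling hh)
  obtain ⟨MG, hMG0, hMG⟩ := hG.exists_transOp_bound hh (OutputTimes.all h)
  obtain ⟨MF, hMF0, hMF⟩ := hF.exists_transOp_bound hh (OutputTimes.all h)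
  set d : ℂ := ((G.D 0 0 : ℝ) : ℂ) with hd
  refine ⟨bG * (MF + bF) + MG * bF + ‖d‖ * bF + bS, by positivity, fun N K z hN hz => ?_⟩
  have : NeZero N := ⟨hN.ne'⟩
  have hNr : (1 : ℝ) ≤ √N := Real.one_le_sqrt.2 (by exact_mod_cast hN)
  have hN0 : (0 : ℝ) < √N := by linarith
  set GN := G.fastMatrix (h / N) N z
  set FN := F.fastMatrix (h / N) N z
  set G0 := G.transOp (OutputTimes.all h) z
  set F0 := F.transOp (OutputTimes.all h) z
  set S0 := F.transOp (OutputTimes.sampling hh) z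
  set κ := filterTransfer K z with hκ
  have e1 : fastApprox G F h m K N z =
      z⁻¹ ^ m • (GN * FN + d • FN) + (-κ) • (holdVec N * sampleVec N * FN) := by
    have hD : F.D 0 0 = 0 := by rw [show F.D = 0 from hF']; rfl
    rw [fastApprox, G.transfer_lift_c2d_eq, F.transfer_lift_c2d_eq, hD, ← hκ]
    simp only [Complex.ofReal_zero, zero_smul, add_zero]
    rw [sub_mul, smul_mul_assoc, add_mul, smul_mul_assoc, one_mul, smul_mul_assoc, neg_smul,
      sub_eq_add_neg]
  -- the feedthrough `d` and the sampler appear only with a factor converging in norm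
  have e2 : stepOp hh (fastApprox G F h m K N z) - errorOp G F hh m K z =
      z⁻¹ ^ m • ((stepOp hh GN - G0) * stepOp hh FN + G0 * (stepOp hh FN - F0) +
        d • (stepOp hh FN - F0)) - κ • (stepOp hh (holdVec N * sampleVec N * FN) - S0) := by
    rw [e1, errorOp, stepOp_add, stepOp_smul, stepOp_smul, stepOp_add, stepOp_mul, stepOp_smul,
      add_mul, smul_mul_assoc, one_mul, sub_mul, mul_sub]
    module
  have hGN : ‖stepOp hh GN - G0‖ ≤ bG / √N := by
    rw [stepOp_eq_kernelOp]; exact hbG N z hz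
  have hFN : ‖stepOp hh FN - F0‖ ≤ bF / √N := by
    rw [stepOp_eq_kernelOp]; exact hbF N z hz
  have hSN : ‖stepOp hh (holdVec N * sampleVec N * FN) - S0‖ ≤ bS / √N := by
    rw [stepOp_hold_sample]; exact hbS N z hz
  have hFN' : ‖stepOp hh FN‖ ≤ MF + bF := by
    have h1 : stepOp hh FN = F0 + (stepOp hh FN - F0) := by abel
    rw [h1]
    exact (norm_add_le _ _).trans
      (add_le_add (hMF z hz) (hFN.trans (div_le_self hbF0 hNr)))
  rw [← norm_stepOp hh]
  refine (abs_norm_sub_norm_le _ _).trans ?_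
  rw [e2]
  have hzm : ‖z⁻¹ ^ m‖ = 1 := by rw [norm_pow, norm_inv, hz, inv_one, one_pow]
  calc _ ≤ (bG / √N * (MF + bF) + MG * (bF / √N) + ‖d‖ * (bF / √N)) + ‖κ‖ * (bS / √N) := by
        refine (norm_sub_le _ _).trans (add_le_add ?_ ?_)
        · rw [norm_smul, hzm, one_mul]
          refine (norm_add_le _ _).trans (add_le_add ((norm_add_le _ _).trans (add_le_add ?_ ?_)) ?_)
          · exact (norm_mul_le _ _).trans
              (mul_le_mul hGN hFN' (norm_nonneg _) (by positivity))
          · exact (norm_mul_le _ _).trans (mul_le_mul (hMG z hz) hFN (norm_nonneg _) hMG0)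
          · rw [norm_smul]
            exact mul_le_mul_of_nonneg_left hFN (norm_nonneg _)
        · rw [norm_smul]
          exact mul_le_mul_of_nonneg_left hSN (norm_nonneg _)
    _ = (bG * (MF + bF) + MG * bF + ‖d‖ * bF + ‖κ‖ * bS) / √N := by ring
    _ ≤ _ := by
        refine div_le_div_of_nonneg_right ?_ hN0.le
        have h1 : 0 ≤ (bG * (MF + bF) + MG * bF + ‖d‖ * bF) * ‖κ‖ := by positivity
        linarith

end ErrorOperator

/-! ### The lifted impulse response of the error system -/

theorem floor_add_div {h : ℝ} (hh : 0 < h) (k : ℕ) {t : ℝ} (ht : t ∈ Ico 0 h) :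
    ⌊((k : ℝ) * h + t) / h⌋₊ = k := by
  have h1 : 0 ≤ ((k : ℝ) * h + t) / h :=
    div_nonneg (add_nonneg (by positivity) ht.1) hh.le
  rw [Nat.floor_eq_iff h1, le_div_iff₀ hh, div_lt_iff₀ hh]
  constructor <;> nlinarith [ht.1, ht.2]

theorem unlifting_add {h : ℝ} (hh : 0 < h) (y : ℕ → ℝ → ℂ) (k : ℕ) {t : ℝ} (ht : t ∈ Ico 0 h) :
    unlifting h y (k * h + t) = y k t := by
  rw [unlifting, if_pos (add_nonneg (by positivity) ht.1), floor_add_div hh k ht,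
    add_sub_cancel_left]

theorem hold_add {h : ℝ} (hh : 0 < h) (ψ : ℕ → ℂ) (k : ℕ) {t : ℝ} (ht : t ∈ Ico 0 h) :
    hold h ψ (k * h + t) = ψ k := by
  rw [hold, if_pos (add_nonneg (by positivity) ht.1), floor_add_div hh k ht]

theorem delay_add {h : ℝ} (hh : 0 < h) (m : ℕ) (y : ℝ → ℂ) (k : ℕ) {t : ℝ} (ht : t ∈ Ico 0 h) :
    delay (m * h) y (k * h + t) = if m ≤ k then y ((k - m : ℕ) * h + t) else 0 := by
  rw [delay]
  by_cases hmk : m ≤ k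
  · have h1 : (m : ℝ) * h ≤ k * h + t := by
      have : (m : ℝ) * h ≤ k * h := mul_le_mul_of_nonneg_right (by exact_mod_cast hmk) hh.le
      linarith [ht.1]
    rw [if_pos h1, if_pos hmk, Nat.cast_sub hmk]
    ring_nf
  · have h1 : ¬ (m : ℝ) * h ≤ k * h + t := by
      have h2 : ((k : ℝ) + 1) ≤ m := by exact_mod_cast not_le.1 hmk
      have : ((k : ℝ) + 1) * h ≤ m * h := mul_le_mul_of_nonneg_right h2 hh.le
      linarith [ht.2]
    rw [if_neg h1, if_neg hmk]

namespace StateSpace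

variable {n : ℕ} (P : StateSpace n 1 1) {h : ℝ}

theorem integrable_impulseResponse_mul (k : ℕ) {t : ℝ} (ht : t ∈ Ico 0 h) {u : ℝ → ℂ}
    (hu : IntegrableOn u (Ico 0 h)) :
    IntegrableOn (fun τ => P.impulseResponse (k * h + t - τ) * u τ) (Ico 0 h) := by
  have hmem := P.impulseResponseKernel_mem (OutputTimes.all h) k
  obtain ⟨C, hC⟩ := hmem.2
  refine Integrable.bdd_mul (c := C) hu
    (BddKernel.measurable_row hmem t).aestronglyMeasurable ?_
  filter_upwards [ae_mem_Ico h] with τ hτ using hC t ht τ hτ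

/-- The output of a system over period `k` is the sum of the responses to the pieces of its input
over the periods up to `k`. -/
theorem output_add (hh : 0 < h) {u : ℝ → ℂ}
    (hu : ∀ i : ℕ, IntegrableOn (fun τ => u (i * h + τ)) (Ico 0 h)) (k : ℕ) {t : ℝ}
    (ht : t ∈ Ico 0 h) :
    P.output u (k * h + t) =
      (∑ i ∈ Finset.range (k + 1),
        ∫ τ in Ico 0 h, P.impulseResponse ((k - i : ℕ) * h + t - τ) * u (i * h + τ)) +
        ((P.D 0 0 : ℝ) : ℂ) * u (k * h + t) := by
  set T : ℝ := k * h + t with hT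
  set g : ℝ → ℂ := fun τ => P.impulseResponse (T - τ) * u τ with hg
  have hT0 : 0 ≤ T := add_nonneg (by positivity) ht.1
  have hT1 : T ≤ ((k + 1 : ℕ) : ℝ) * h := by
    rw [hT]; push_cast; linarith [ht.2]
  have hshift : ∀ i ∈ Finset.range (k + 1), ∀ τ, g (i * h + τ) =
      P.impulseResponse ((k - i : ℕ) * h + t - τ) * u (i * h + τ) := by
    intro i hi τ
    have hik : i ≤ k := Nat.lt_succ_iff.1 (Finset.mem_range.1 hi)
    rw [hg, hT, Nat.cast_sub hik]
    ring_nf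
  have hpiece : ∀ i ∈ Finset.range (k + 1),
      IntervalIntegrable g volume ((i : ℕ) * h) ((i + 1 : ℕ) * h) := by
    intro i hi
    have h1 : IntegrableOn (fun τ => g (i * h + τ)) (Ico 0 h) := by
      simp_rw [hshift i hi]
      exact P.integrable_impulseResponse_mul (k - i) ht (hu i)
    have h2 : IntervalIntegrable (fun τ => g (i * h + τ)) volume 0 h :=
      (intervalIntegrable_iff_integrableOn_Ico_of_le hh.le).2 h1
    have h3 := h2.comp_add_left (-(i * h))
    convert h3 using 1
    · funext τ
      ring_nf
    · ring
    · push_cast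
      ring
  have hint : IntervalIntegrable g volume 0 ((k + 1 : ℕ) * h) := by
    have := IntervalIntegrable.trans_iterate (a := fun i : ℕ => (i : ℝ) * h) (n := k + 1)
      fun i hi => hpiece i (Finset.mem_range.2 hi)
    simpa using this
  -- cut `[0, (k + 1) h]` into periods and shift each of them to `[0, h)`
  have hsum : ∑ i ∈ Finset.range (k + 1),
      ∫ τ in Ico 0 h, P.impulseResponse ((k - i : ℕ) * h + t - τ) * u (i * h + τ) =
      ∫ τ in (0 : ℝ)..((k + 1 : ℕ) * h), g τ := by
    have h1 := intervalIntegral.sum_integral_adjacent_intervals (μ := volume) (f := g)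
      (a := fun i : ℕ => (i : ℝ) * h) (n := k + 1)
      fun i hi => hpiece i (Finset.mem_range.2 hi)
    rw [Nat.cast_zero, zero_mul] at h1
    rw [← h1]
    refine Finset.sum_congr rfl fun i hi => ?_
    have h2 : ∫ τ in ((i : ℝ) * h)..((i + 1 : ℕ) * h), g τ = ∫ τ in (0 : ℝ)..h, g (i * h + τ) := by
      rw [intervalIntegral.integral_comp_add_left]
      congr 1 <;> push_cast <;> ring
    rw [h2, intervalIntegral.integral_of_le hh.le, ← integral_Ico_eq_integral_Ioc]
    simp_rw [hshift i hi]
  -- the impulse response vanishes at negative times, so times after `T` do not contribute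
  have hsplit : ∫ τ in (0 : ℝ)..((k + 1 : ℕ) * h), g τ = ∫ τ in (0 : ℝ)..T, g τ := by
    have h1 : IntervalIntegrable g volume 0 T :=
      hint.mono_set (by
        rw [uIcc_of_le hT0, uIcc_of_le (hT0.trans hT1)]
        exact Icc_subset_Icc_right hT1)
    have h2 : IntervalIntegrable g volume T ((k + 1 : ℕ) * h) :=
      hint.mono_set (by
        rw [uIcc_of_le hT1, uIcc_of_le (hT0.trans hT1)]
        exact Icc_subset_Icc_left hT0)
    have h3 : ∫ τ in T..((k + 1 : ℕ) * h), g τ = 0 := by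
      rw [intervalIntegral.integral_congr (g := fun _ => (0 : ℂ))]
      · simp
      · intro τ hτ
        rw [uIcc_of_le hT1] at hτ
        have : ¬ 0 < T - τ := by linarith [hτ.1]
        simp only [hg, impulseResponse, if_neg this, zero_mul]
    rw [← intervalIntegral.integral_add_adjacent_intervals h1 h2, h3, add_zero]
  rw [hsum, hsplit, output]
  congr 1
  rw [intervalIntegral.integral_of_le hT0, intervalIntegral.integral_of_le hT0,
    integral_Ioc_eq_integral_Ioo, integral_Ioc_eq_integral_Ioo]
  refine setIntegral_congr_fun measurableSet_Ioo fun τ hτ => ?_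
  have : 0 < T - τ := by linarith [hτ.2]
  simp only [hg, impulseResponse, if_pos this]

/-- The output of a strictly proper system after an input over period `0`. -/
theorem IsStrictlyProper.output_unlifting {P : StateSpace n 1 1} (hP : P.IsStrictlyProper)
    (hh : 0 < h) (f : L2 h) (k : ℕ) {t : ℝ} (ht : t ∈ Ico 0 h) :
    P.output (unlifting h (Pi.single 0 (f : ℝ → ℂ))) (k * h + t) =
      ∫ τ in Ico 0 h, P.impulseResponse (k * h + t - τ) * f τ := by
  have hw : ∀ i : ℕ, ∀ τ ∈ Ico 0 h, unlifting h (Pi.single 0 (f : ℝ → ℂ)) (i * h + τ) =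
      (Pi.single 0 (f : ℝ → ℂ) : ℕ → ℝ → ℂ) i τ := fun i τ hτ => unlifting_add hh _ i hτ
  have hint : ∀ i : ℕ, IntegrableOn
      (fun τ => unlifting h (Pi.single 0 (f : ℝ → ℂ)) (i * h + τ)) (Ico 0 h) := by
    intro i
    rw [integrableOn_congr_fun (hw i) measurableSet_Ico]
    rcases eq_or_ne i 0 with rfl | hi
    · rw [Pi.single_eq_same]
      exact L2.integrable f
    · rw [Pi.single_eq_of_ne hi]
      exact integrableOn_zero
  have hD : P.D 0 0 = 0 := by rw [show P.D = 0 from hP]; rfl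
  rw [P.output_add hh hint k ht, hD, Complex.ofReal_zero, zero_mul, add_zero,
    Finset.sum_eq_single_of_mem 0 (by simp)]
  · refine setIntegral_congr_fun measurableSet_Ico fun τ hτ => ?_
    simp only [hw 0 τ hτ, Pi.single_eq_same, Nat.sub_zero]
  · intro i _ hi
    rw [← integral_zero ℝ ℂ (μ := volume.restrict (Ico 0 h))]
    refine setIntegral_congr_fun measurableSet_Ico fun τ hτ => ?_
    simp only [hw i τ hτ, Pi.single_eq_of_ne hi, Pi.zero_apply, mul_zero]

end StateSpace

section ErrorImpulseResponse

variable {a b : ℕ} (G : StateSpace a 1 1) (F : StateSpace b 1 1) {h : ℝ}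

/-- The impulse response of the lifting of the series connection `G F`, for `F` strictly proper. -/
noncomputable def seriesOp (h : ℝ) (k : ℕ) : L2 h →L[ℂ] L2 h :=
  ∑ i ∈ Finset.range (k + 1),
      G.respOp (OutputTimes.all h) (k - i) * F.respOp (OutputTimes.all h) i +
    ((G.D 0 0 : ℝ) : ℂ) • F.respOp (OutputTimes.all h) k

/-- The impulse response of the lifted error system. -/
noncomputable def errorRespOp (hh : 0 < h) (m : ℕ) (K : ℕ → ℝ) (k : ℕ) : L2 h →L[ℂ] L2 h :=
  (if m ≤ k then seriesOp G F h (k - m) else 0) -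
    ∑ i ∈ Finset.range (k + 1), (K (k - i) : ℂ) • F.respOp (OutputTimes.sampling hh) i

variable {F}

theorem seriesOp_apply (hh : 0 < h) (hF' : F.IsStrictlyProper) (k : ℕ) (f : L2 h) :
    seriesOp G F h k f =ᵐ[volume.restrict (Ico (0 : ℝ) h)] fun t =>
      G.output (F.output (unlifting h (Pi.single 0 (f : ℝ → ℂ)))) (k * h + t) := by
  set y := F.output (unlifting h (Pi.single 0 (f : ℝ → ℂ))) with hy
  have hy' : ∀ i : ℕ, (fun τ => y (i * h + τ)) =ᵐ[volume.restrict (Ico (0 : ℝ) h)]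
      F.respOp (OutputTimes.all h) i f := by
    intro i
    filter_upwards [F.respOp_apply (OutputTimes.all h) i f, ae_mem_Ico h] with τ h1 hτ
    rw [h1, hy, hF'.output_unlifting hh f i hτ]
    rfl
  have hint : ∀ i : ℕ, IntegrableOn (fun τ => y (i * h + τ)) (Ico 0 h) := fun i =>
    (L2.integrable _).congr (hy' i).symm
  have hG : ∀ᵐ t ∂(volume.restrict (Ico (0 : ℝ) h)), ∀ i : ℕ,
      G.respOp (OutputTimes.all h) (k - i) (F.respOp (OutputTimes.all h) i f) t =
        ∫ τ in Ico 0 h, G.impulseResponse ((k - i : ℕ) * h + t - τ) * y (i * h + τ) := by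
    rw [ae_all_iff]
    intro i
    filter_upwards [G.respOp_apply (OutputTimes.all h) (k - i)
      (F.respOp (OutputTimes.all h) i f)] with t h1
    rw [h1]
    refine integral_congr_ae ?_
    filter_upwards [hy' i] with τ hτ
    rw [hτ]
    rfl
  have hsum : ⇑(∑ i ∈ Finset.range (k + 1), G.respOp (OutputTimes.all h) (k - i)
      (F.respOp (OutputTimes.all h) i f)) =ᵐ[volume.restrict (Ico (0 : ℝ) h)]
      fun t => ∑ i ∈ Finset.range (k + 1), G.respOp (OutputTimes.all h) (k - i)
        (F.respOp (OutputTimes.all h) i f) t :=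
    Lp.coeFn_fun_finsetSum _ _
  have happ : seriesOp G F h k f = (∑ i ∈ Finset.range (k + 1), G.respOp (OutputTimes.all h) (k - i)
      (F.respOp (OutputTimes.all h) i f)) +
        ((G.D 0 0 : ℝ) : ℂ) • F.respOp (OutputTimes.all h) k f := by
    rw [seriesOp, add_apply, sum_apply]
    rfl
  rw [happ]
  filter_upwards [hG, hsum, hy' k, ae_mem_Ico h,
    Lp.coeFn_add (∑ i ∈ Finset.range (k + 1), G.respOp (OutputTimes.all h) (k - i)
      (F.respOp (OutputTimes.all h) i f)) (((G.D 0 0 : ℝ) : ℂ) • F.respOp (OutputTimes.all h) k f),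
    Lp.coeFn_smul ((G.D 0 0 : ℝ) : ℂ) (F.respOp (OutputTimes.all h) k f)] with t h1 h2 h3 ht h4 h5
  rw [h4, Pi.add_apply, h2, h5, Pi.smul_apply, ← h3, smul_eq_mul, G.output_add hh hint k ht]
  simp_rw [h1]

theorem isLiftedImpulseResponse_errorRespOp (hh : 0 < h) (hF' : F.IsStrictlyProper) (m : ℕ)
    (K : ℕ → ℝ) :
    IsLiftedImpulseResponse h (errorSystem G F h m K) (errorRespOp G F hh m K) := by
  intro k f
  set y := F.output (unlifting h (Pi.single 0 (f : ℝ → ℂ))) with hy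
  have hsamp : ∀ᵐ t ∂(volume.restrict (Ico (0 : ℝ) h)), ∀ i : ℕ,
      F.respOp (OutputTimes.sampling hh) i f t = y (i * h) := by
    rw [ae_all_iff]
    intro i
    filter_upwards [F.respOp_apply (OutputTimes.sampling hh) i f] with t h1
    have h2 := hF'.output_unlifting hh f i (t := 0) ⟨le_rfl, hh⟩
    simp only [add_zero] at h2
    rw [h1, hy, h2]
    simp [OutputTimes.sampling]
  have hsum : ⇑(∑ i ∈ Finset.range (k + 1), (K (k - i) : ℂ) •
      F.respOp (OutputTimes.sampling hh) i f) =ᵐ[volume.restrict (Ico (0 : ℝ) h)]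
      fun t => ∑ i ∈ Finset.range (k + 1), (K (k - i) : ℂ) *
        F.respOp (OutputTimes.sampling hh) i f t := by
    have hsmul : ∀ᵐ t ∂(volume.restrict (Ico (0 : ℝ) h)), ∀ i : ℕ,
        ((K (k - i) : ℂ) • F.respOp (OutputTimes.sampling hh) i f) t =
          (K (k - i) : ℂ) * F.respOp (OutputTimes.sampling hh) i f t := by
      rw [ae_all_iff]
      exact fun i => Lp.coeFn_smul _ _
    filter_upwards [hsmul, Lp.coeFn_fun_finsetSum (Finset.range (k + 1)) fun i =>
      (K (k - i) : ℂ) • F.respOp (OutputTimes.sampling hh) i f] with t h1 h2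
    rw [h2]
    exact Finset.sum_congr rfl fun i _ => h1 i
  have hdelay : ⇑((if m ≤ k then seriesOp G F h (k - m) else 0 : L2 h →L[ℂ] L2 h) f)
      =ᵐ[volume.restrict (Ico (0 : ℝ) h)]
      fun t => if m ≤ k then G.output y ((k - m : ℕ) * h + t) else 0 := by
    split_ifs
    · exact seriesOp_apply G hh hF' (k - m) f
    · exact Lp.coeFn_zero _ _ _
  have happ : errorRespOp G F hh m K k f =
      (if m ≤ k then seriesOp G F h (k - m) else 0 : L2 h →L[ℂ] L2 h) f -
        ∑ i ∈ Finset.range (k + 1), (K (k - i) : ℂ) • F.respOp (OutputTimes.sampling hh) i f := by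
    rw [errorRespOp, sub_apply, sum_apply]
    rfl
  rw [happ]
  filter_upwards [hsamp, hsum, hdelay, ae_mem_Ico h, Lp.coeFn_sub
    ((if m ≤ k then seriesOp G F h (k - m) else 0 : L2 h →L[ℂ] L2 h) f)
    (∑ i ∈ Finset.range (k + 1), (K (k - i) : ℂ) • F.respOp (OutputTimes.sampling hh) i f)]
    with t h1 h2 h3 ht h4
  rw [h4, Pi.sub_apply, h3, h2, lifting, errorSystem, hold_add hh _ k ht, delay_add hh m _ k ht,
    digitalFilter]
  simp_rw [h1]
  rfl

end ErrorImpulseResponse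

/-! ### The transfer function of the lifted error system -/

section TransferValue

variable {V : Type*} [NormedAddCommGroup V] [NormedSpace ℂ V]

theorem hasSum_polynomial_convolution {Φ : ℕ → V} {x : ℂ} {T : V}
    (hT : HasSum (fun k : ℕ => x ^ k • Φ k) T) (r : Polynomial ℂ) :
    HasSum (fun k : ℕ => x ^ k • ∑ i ∈ Finset.range (k + 1), r.coeff i • Φ (k - i))
      (r.eval x • T) := by
  have h1 : HasSum (fun k : ℕ => x ^ k • ∑ i ∈ Finset.range (k + 1),
      (1 : Polynomial ℂ).coeff i • Φ (k - i)) T := by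
    simpa [Polynomial.coeff_one] using hT
  simpa only [mul_one] using HasTransferValue.mul_aux h1 r

theorem HasTransferValue.of_hasSum {Φ : ℕ → V} {z : ℂ} {T : V}
    (hT : HasSum (fun k : ℕ => z⁻¹ ^ k • Φ k) T) : HasTransferValue Φ z T :=
  ⟨1, by simp, hasSum_polynomial_convolution hT 1⟩

/-- A delay by `m` steps multiplies the transfer function by `z⁻ᵐ`. -/
theorem hasSum_delay {Φ : ℕ → V} {x : ℂ} {T : V} (hT : HasSum (fun k : ℕ => x ^ k • Φ k) T)
    (m : ℕ) : HasSum (fun k : ℕ => x ^ k • if m ≤ k then Φ (k - m) else 0) (x ^ m • T) := by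
  rw [← hasSum_nat_add_iff' m, Finset.sum_eq_zero, sub_zero]
  · convert hT.const_smul (x ^ m) using 1
    funext k
    rw [if_pos (Nat.le_add_left m k), Nat.add_sub_cancel, pow_add, mul_comm, mul_smul]
  · intro k hk
    rw [if_neg (not_le.2 (Finset.mem_range.1 hk)), smul_zero]

/-- If the transfer functions of `Φ` and of a scalar filter `K` are regular, the former with an
absolutely convergent series, then the denominator of `K` also serves for the convolution. -/
theorem hasSum_convolution [CompleteSpace V] {Φ : ℕ → V →L[ℂ] V} {x : ℂ} {T : V →L[ℂ] V}
    (hΦ : Summable fun k : ℕ => ‖x ^ k • Φ k‖) (hT : HasSum (fun k : ℕ => x ^ k • Φ k) T)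
    {K : ℕ → ℂ} {r : ℕ → ℂ} {c : ℂ}
    (hK : HasSum (fun k : ℕ => x ^ k • ∑ i ∈ Finset.range (k + 1), r i • K (k - i)) c) :
    HasSum (fun k : ℕ => x ^ k • ∑ i ∈ Finset.range (k + 1),
      r i • ∑ j ∈ Finset.range (k - i + 1), K (k - i - j) • Φ j) (c • T) := by
  have hK1 : Summable fun k : ℕ => ‖(x ^ k • ∑ i ∈ Finset.range (k + 1), r i • K (k - i)) •
      (1 : V →L[ℂ] V)‖ := by
    simp_rw [norm_smul _ (1 : V →L[ℂ] V)]
    exact hK.summable.norm.mul_right _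
  have hK2 := hK.smul_const (1 : V →L[ℂ] V)
  have h1 := hasSum_sum_range_mul_of_summable_norm hΦ hK1
  rw [hT.tsum_eq, hK2.tsum_eq, mul_smul_comm, mul_one] at h1
  refine h1.congr_fun fun k => ?_
  simp_rw [Finset.smul_sum]
  rw [Finset.sum_comm' (t' := Finset.range (k + 1)) (s' := fun j => Finset.range (k - j + 1))
    (by intro i j; simp only [Finset.mem_range]; omega)]
  refine Finset.sum_congr rfl fun j hj => ?_
  have hjk : j ≤ k := Nat.lt_succ_iff.1 (Finset.mem_range.1 hj)
  rw [mul_smul_comm, mul_one, Finset.sum_smul]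
  refine Finset.sum_congr rfl fun i hi => ?_
  rw [smul_smul, smul_smul, smul_smul, Nat.sub_right_comm, smul_eq_mul, smul_eq_mul]
  congr 1
  have hx : x ^ k = x ^ (k - j) * x ^ j := by rw [← pow_add, Nat.sub_add_cancel hjk]
  rw [hx]
  ring

end TransferValue

section ErrorTransfer

variable {a b : ℕ} {G : StateSpace a 1 1} {F : StateSpace b 1 1} {h : ℝ} {z : ℂ}

theorem hasSum_seriesOp (hG : G.IsHurwitz) (hF : F.IsHurwitz) (hh : 0 < h) (hz : ‖z‖ = 1) :
    HasSum (fun k : ℕ => z⁻¹ ^ k • seriesOp G F h k)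
      ((G.transOp (OutputTimes.all h) z + ((G.D 0 0 : ℝ) : ℂ) • 1) *
        F.transOp (OutputTimes.all h) z) := by
  have hFs := hF.hasSum_respOp hh hz (OutputTimes.all h)
  have h1 := hasSum_sum_range_mul_of_summable_norm
    (hG.summable_norm_respOp hh hz (OutputTimes.all h))
    (hF.summable_norm_respOp hh hz (OutputTimes.all h))
  rw [(hG.hasSum_respOp hh hz (OutputTimes.all h)).tsum_eq, hFs.tsum_eq] at h1
  have h2 := h1.add (hFs.const_smul ((G.D 0 0 : ℝ) : ℂ))
  rw [add_mul, smul_mul_assoc, one_mul]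
  refine h2.congr_fun fun k => ?_
  rw [seriesOp, smul_add, smul_comm (z⁻¹ ^ k), Finset.smul_sum]
  congr 1
  rw [← Finset.sum_flip]
  refine Finset.sum_congr rfl fun i hi => ?_
  have hik : i ≤ k := Nat.lt_succ_iff.1 (Finset.mem_range.1 hi)
  rw [Nat.sub_sub_self hik, smul_mul_smul_comm, ← pow_add, Nat.add_sub_cancel' hik]

theorem hasTransferValue_errorRespOp (hG : G.IsHurwitz) (hF : F.IsHurwitz) (hh : 0 < h) (m : ℕ)
    {K : ℕ → ℝ} (hz : ‖z‖ = 1) (hK : IsRegularAt K z) :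
    HasTransferValue (errorRespOp G F hh m K) z (errorOp G F hh m K z) := by
  obtain ⟨c, hc⟩ := hK
  have hcK : filterTransfer K z = c := hc.transferValue_eq
  obtain ⟨r, hr, hs⟩ := hc
  refine ⟨r, hr, ?_⟩
  have h1 := hasSum_polynomial_convolution (hasSum_delay (hasSum_seriesOp hG hF hh hz) m) r
  have h2 : HasSum (fun k : ℕ => z⁻¹ ^ k • ∑ i ∈ Finset.range (k + 1),
      r.coeff i • ∑ j ∈ Finset.range (k - i + 1),
        (K (k - i - j) : ℂ) • F.respOp (OutputTimes.sampling hh) j)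
      ((r.eval z⁻¹ • c) • F.transOp (OutputTimes.sampling hh) z) :=
    hasSum_convolution (hF.summable_norm_respOp hh hz (OutputTimes.sampling hh))
      (hF.hasSum_respOp hh hz (OutputTimes.sampling hh)) (K := fun k => (K k : ℂ))
      (r := fun i => r.coeff i) (c := r.eval z⁻¹ • c) hs
  have h3 := h1.sub h2
  rw [errorOp, hcK, smul_sub]
  rw [smul_assoc] at h3
  refine h3.congr_fun fun k => ?_
  rw [← smul_sub, ← Finset.sum_sub_distrib]
  congr 1
  refine Finset.sum_congr rfl fun i _ => ?_
  rw [errorRespOp, smul_sub]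

end ErrorTransfer

/-! ### Filters on the unit circle -/

theorem norm_circlePt (h ω : ℝ) : ‖circlePt h ω‖ = 1 := by
  rw [circlePt, Complex.norm_exp_I_mul_ofReal]

theorem StableFilter.hasSum (K : StableFilter) {z : ℂ} (hz : ‖z‖ = 1) :
    HasSum (fun k : ℕ => z⁻¹ ^ k • (K.impulse k : ℂ)) (∑' k : ℕ, z⁻¹ ^ k • (K.impulse k : ℂ)) := by
  refine (Summable.of_norm ?_).hasSum
  simpa [norm_smul, hz] using K.stable

theorem StableFilter.isRegularAt (K : StableFilter) {z : ℂ} (hz : ‖z‖ = 1) :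
    IsRegularAt K.impulse z :=
  ⟨_, HasTransferValue.of_hasSum (K.hasSum hz)⟩

theorem StableFilter.norm_filterTransfer_le (K : StableFilter) {z : ℂ} (hz : ‖z‖ = 1) :
    ‖filterTransfer K.impulse z‖ ≤ ∑' k : ℕ, |K.impulse k| := by
  rw [filterTransfer, (HasTransferValue.of_hasSum (K.hasSum hz)).transferValue_eq]
  refine tsum_of_norm_bounded K.stable.hasSum fun k => ?_
  simp [hz]

/-- A set of stable filters that is compact for the `H^∞` norm is bounded in it. -/
theorem exists_bound_filterTransfer {𝒦 : Set StableFilter} (h𝒦 : IsCompact 𝒦) :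
    ∃ B : ℝ, 0 ≤ B ∧ ∀ K ∈ 𝒦, ∀ z : ℂ, ‖z‖ = 1 → ‖filterTransfer K.impulse z‖ ≤ B := by
  refine h𝒦.induction_on (p := fun s : Set StableFilter => ∃ B : ℝ, 0 ≤ B ∧ ∀ K ∈ s, ∀ z : ℂ,
    ‖z‖ = 1 → ‖filterTransfer K.impulse z‖ ≤ B) ⟨0, le_rfl, by simp⟩ ?_ ?_ ?_
  · rintro s t hst ⟨B, hB0, hB⟩
    exact ⟨B, hB0, fun K hK => hB K (hst hK)⟩
  · rintro s t ⟨B, hB0, hB⟩ ⟨B', hB0', hB'⟩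
    refine ⟨max B B', le_max_of_le_left hB0, ?_⟩
    rintro K (hK | hK) z hz
    · exact (hB K hK z hz).trans (le_max_left _ _)
    · exact (hB' K hK z hz).trans (le_max_right _ _)
  · intro K₀ _
    refine ⟨{K | ∀ z : Circle, dist (filterTransfer K₀.impulse (z : ℂ))
      (filterTransfer K.impulse (z : ℂ)) < 1}, ?_, ∑' k : ℕ, |K₀.impulse k| + 1, by positivity,
      fun K hK z hz => ?_⟩
    · refine mem_nhdsWithin_of_mem_nhds ?_
      rw [nhds_induced]
      have := (UniformFun.hasBasis_nhds_of_basis Circle ℂ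
        (UniformFun.ofFun fun z : Circle => filterTransfer K₀.impulse (z : ℂ))
        Metric.uniformity_basis_dist).mem_of_mem (i := 1) one_pos
      exact mem_of_superset (preimage_mem_comap this) fun K hK => hK
    · have h1 := hK ⟨z, mem_sphere_zero_iff_norm.2 hz⟩
      have h2 := K₀.norm_filterTransfer_le hz
      have h3 := norm_sub_norm_le (filterTransfer K.impulse z) (filterTransfer K₀.impulse z)
      rw [dist_comm, dist_eq_norm] at h1
      change ‖filterTransfer K.impulse z - filterTransfer K₀.impulse z‖ < 1 at h1
      linarith

end SampledData

theorem theorem1 {a b : ℕ} (G : SampledData.StateSpace a 1 1) (F : SampledData.StateSpace b 1 1)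
    (hG : G.IsHurwitz) (hF : F.IsHurwitz) (hF' : F.IsStrictlyProper)
    (h : ℝ) (hh : 0 < h) (m : ℕ) :
    ∃ Etilde : (ℕ → ℝ) → ℝ → (SampledData.L2 h →L[ℂ] SampledData.L2 h),
      (∀ (K : ℕ → ℝ), ∀ ω ∈ Set.Ico 0 (2 * Real.pi / h),
        SampledData.IsRegularAt K (SampledData.circlePt h ω) →
          SampledData.IsLiftedTransferValue h (SampledData.errorSystem G F h m K)
              (SampledData.circlePt h ω) (Etilde K ω) ∧
            Filter.Tendsto
              (fun N : ℕ => SampledData.matNorm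
                (SampledData.fastApprox G F h m K N (SampledData.circlePt h ω)))
              Filter.atTop (nhds ‖Etilde K ω‖)) ∧
      (∀ 𝒦 : Set SampledData.StableFilter, IsCompact 𝒦 →
        (∀ K ∈ 𝒦, ∀ ω ∈ Set.Ico 0 (2 * Real.pi / h),
          SampledData.IsRegularAt K.impulse (SampledData.circlePt h ω)) ∧
        TendstoUniformlyOn
          (fun (N : ℕ) (x : SampledData.StableFilter × ℝ) => SampledData.matNorm
            (SampledData.fastApprox G F h m x.1.impulse N (SampledData.circlePt h x.2)))
          (fun x : SampledData.StableFilter × ℝ => ‖Etilde x.1.impulse x.2‖)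
          Filter.atTop (𝒦 ×ˢ Set.Ico 0 (2 * Real.pi / h))) := by
  obtain ⟨C, hC0, hC⟩ := SampledData.exists_abs_matNorm_sub_le hh hG hF hF' m
  have hlim : ∀ B : ℝ, Tendsto (fun N : ℕ => C * (1 + B) / √(N : ℝ)) atTop (𝓝 0) := fun B =>
    Tendsto.div_atTop tendsto_const_nhds (Real.tendsto_sqrt_atTop.comp tendsto_natCast_atTop_atTop)
  refine ⟨fun K ω => SampledData.errorOp G F hh m K (SampledData.circlePt h ω),
    fun K ω _ hK => ⟨?_, ?_⟩, fun 𝒦 h𝒦 => ⟨fun K _ ω _ => ?_, ?_⟩⟩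
  · exact ⟨_, SampledData.isLiftedImpulseResponse_errorRespOp G hh hF' m K,
      SampledData.hasTransferValue_errorRespOp hG hF hh m (SampledData.norm_circlePt h ω) hK⟩
  · rw [tendsto_iff_norm_sub_tendsto_zero]
    refine squeeze_zero' (Eventually.of_forall fun N => norm_nonneg _) ?_
      (hlim ‖SampledData.filterTransfer K (SampledData.circlePt h ω)‖)
    filter_upwards [eventually_gt_atTop 0] with N hN
    exact hC N K _ hN (SampledData.norm_circlePt h ω)
  · exact K.isRegularAt (SampledData.norm_circlePt h ω)
  · obtain ⟨B, hB0, hB⟩ := SampledData.exists_bound_filterTransfer h𝒦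
    rw [Metric.tendstoUniformlyOn_iff]
    intro ε hε
    filter_upwards [eventually_gt_atTop 0, (hlim B).eventually_lt_const hε] with N hN hNε
    rintro ⟨K, ω⟩ ⟨hK, _⟩
    rw [dist_comm, Real.dist_eq]
    refine ((hC N K.impulse _ hN (SampledData.norm_circlePt h ω)).trans ?_).trans_lt hNε
    refine div_le_div_of_nonneg_right (mul_le_mul_of_nonneg_left ?_ hC0) (Real.sqrt_nonneg _)
    exact add_le_add le_rfl (hB K hK _ (SampledData.norm_circlePt h ω))
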